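/- Let $\lambda$ be a limit ordinal. Let $\mathcal{E}_\lambda$ be the set of all nontrivial (that is, non-identity) elementary embeddings $j\colon (V_\lambda,\in)\to(V_\lambda,\in)$, each identified with its graph $\{\langle x,j(x)\rangle : x\in V_\lambda\}\subseteq V_\lambda$. For $j\in\mathcal{E}_\lambda$ let $\operatorname{crit} j$ be the least ordinal $\kappa$ with $\kappa<j(\kappa)$ and let $\operatorname{rng} j$ be the range of $j$. For $A\subseteq V_\lambda$ put $j\cdot A=\bigcup_{\alpha<\lambda}j(A\cap V_\alpha)$; for $k\in\mathcal{E}_\lambda$ this gives the application $jk=j\cdot k\in\mathcal{E}_\lambda$, and $j j_1\cdots j_n$ denotes $(\cdots((j j_1)j_2)\cdots)j_n$. For $A\subseteq V_\lambda$ let $\mathrm{Def}^{V_\lambda}(A)$ be the set of those $b\in V_\lambda$ for which there are a first-order formula $\varphi(x,y_1,\dots,y_m)$ in the language $\{\in\}$ and $a_1,\dots,a_m\in A$ such that $b$ is the unique element of $V_\lambda$ with $V_\lambda\models\varphi[b,a_1,\dots,a_m]$. Suppose that $j\in\mathcal{E}_\lambda$, that $\delta$ and $\mu$ are cardinals with $\operatorname{crit}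 j<\delta<\mu<\lambda$, and that $$\mathrm{Def}^{V_\lambda}(\operatorname{rng} j\cup V_\delta)\cap[\delta,\mu)=\emptyset.$$ Then for every $n\ge 0$ and all $j_1,\dots,j_n\in\mathcal{E}_\lambda$ such that $\operatorname{crit}(j j_1\cdots j_i)<\delta$ for all $i\le n$, the embedding $k=j j_1\cdots j_n$ satisfies $$\operatorname{rng} k\cap[\delta,\mu)=\emptyset.$$ -/

import Mathlib

universe u

namespace RankToRank

open FirstOrder ZFSet

/-- The relation symbols of the language of set theory: one binary symbol. -/
inductive MemRel : ℕ → Type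
  | mem : MemRel 2

/-- The language of set theory `{∈}`. -/
def setLang : Language := ⟨fun _ => Empty, MemRel⟩

/-- The elements of the rank-initial segment `V_lam` of the universe of sets. -/
abbrev Rank (lam : Ordinal.{u}) : Type (u + 1) := {x : ZFSet.{u} // x ∈ V_ lam}

/-- `V_lam` as a structure for the language of set theory, with the true membership relation. -/
instance rankStructure (lam : Ordinal.{u}) : setLang.Structure (Rank lam) where
  funMap f := nomatch f
  RelMap | .mem => fun x => (x 0).1 ∈ (x 1).1

/-- The graph of a function `V_lam → V_lam`, the set of all ordered pairs `⟨x, e x⟩`. -/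
noncomputable def graph {lam : Ordinal.{u}} (e : Rank lam → Rank lam) : ZFSet.{u} :=
  ZFSet.range fun x : Rank lam => pair x.1 (e x).1

/-- `𝓔_lam`: the set of nontrivial elementary embeddings `V_lam → V_lam`, each of them encoded
as its graph, which is a subset of `V_lam` when `lam` is a limit ordinal. -/
def Emb (lam : Ordinal.{u}) : Set ZFSet.{u} :=
  {f | ∃ e : Rank lam ↪ₑ[setLang] Rank lam, (∃ x, e x ≠ x) ∧ f = graph e}

/-- The value `f(x)` of a function `f` (a set of ordered pairs) at `x`:
the unique `y` with `⟨x, y⟩ ∈ f` if `x` is in the domain of `f`, and `∅` if it is not. -/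
noncomputable def val (f x : ZFSet.{u}) : ZFSet.{u} :=
  ⋃₀ ((⋃₀ (⋃₀ f : ZFSet.{u}) : ZFSet.{u}).sep fun y => pair x y ∈ f)

/-- The range of a function. -/
def rng (f : ZFSet.{u}) : Set ZFSet.{u} :=
  {y | ∃ x, pair x y ∈ f}

/-- The critical point: the least ordinal `κ` with `κ < f(κ)`. -/
noncomputable def crit (f : ZFSet.{u}) : Ordinal.{u} :=
  sInf {κ | κ.toZFSet ∈ val f κ.toZFSet}

/-- The application `j · A = ⋃_{α < lam} j(A ∩ V_α)` of `j : V_lam → V_lam` to `A ⊆ V_lam`.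
When `A` is (the graph of) an embedding `k`, this is (the graph of) the embedding `j k`. -/
noncomputable def app (lam : Ordinal.{u}) (j A : ZFSet.{u}) : ZFSet.{u} :=
  ZFSet.iUnion fun α : Set.Iio lam => val j (A ∩ V_ α.1)

/-- The left-parenthesized product `((j · js 0) · js 1) ⋯ js (n - 1)` of `j` and the
first `n` terms of `js`. -/
noncomputable def leftProd (lam : Ordinal.{u}) (j : ZFSet.{u}) (js : ℕ → ZFSet.{u}) : ℕ → ZFSet.{u}
  | 0 => j
  | n + 1 => app lam (leftProd lam j js n) (js n)

/-- `Def^{V_lam}(A)`: the elements of `V_lam` that are definable in the structure `V_lam` by a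
first-order formula with parameters from `A`. -/
def DefIn (lam : Ordinal.{u}) (A : Set ZFSet.{u}) : Set ZFSet.{u} :=
  {b | ∃ hb : b ∈ V_ lam,
    Set.Definable₁ {x : Rank lam | x.1 ∈ A} setLang {(⟨b, hb⟩ : Rank lam)}}

/-- The set of ordinals `[δ, μ)`, as von Neumann ordinals. -/
def interval (δ μ : Ordinal.{u}) : Set ZFSet.{u} :=
  Ordinal.toZFSet '' Set.Ico δ μ

end RankToRank

/-! The proof is an induction on `n` of a stronger statement: every product `g = j j_1 ⋯ j_i` has
`Def(rng g ∪ V_δ) ∩ [δ, μ) = ∅`. This gives the conclusion, as elements of `rng g` are definable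
from themselves.

For the inductive step (`defIn_app_inter_interval`) let `g = e f`. Since `g` is the union of the
sets `e(f ∩ V_α)`, each value `g(x)` is read off at `x` from a function in `rng e`, so it is
definable from `rng e ∪ {x}`. As `crit g < δ`, Kunen's theorem gives `a < δ` with `g(a) ≥ δ`
(`exists_le_ordMap`). This `g(a)` is definable from `rng e ∪ V_δ`, so it jumps over the gap: `g(a) ≥
μ`. Now let a formula define `o ∈ [δ, μ)` from `g(x)` and a tuple `p` from `V_δ`. The partial
function `s` taking a tuple `q` from `V_a` to the ordinal below `a` that the formula defines from
`x` and `q` lies in `V_δ`, because `δ` is a limit. By elementarity `g(s)` does the same for `g(x)`,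
on tuples from `V_{g(a)}` and below `g(a)`; hence `o = g(s)(p)` (`exists_map_definition`), and `o`
is definable from `rng e ∪ V_δ`, a contradiction.

Kunen's theorem enters as cofinality of the critical sequence in `lam` (`not_iSup_critSeq_lt`). If
its supremum `l` were below `lam`, then `e(l) = l` and `2^l ≤ l^ω`, so some `F : l^ω → l` takes
every value on the sequences from the range of any injection of `l`. Then `e(F)` has this property
inside `V_lam`; applied to `e ↾ l` it gives `crit e = e(F)(e ∘ t) = e(F)(e(t)) = e(F(t))`, but the
critical point is not in the range of `e`. -/

namespace RankToRank

open FirstOrder ZFSet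

/-! ### Parameter-free definable predicates over `V_lam` -/

variable {lam : Ordinal.{u}} {α β : Type}

/-- A predicate on tuples from `V_lam` that is the truth set of a parameter-free formula. -/
def Expressible (P : (α → Rank lam) → Prop) : Prop :=
  ∃ φ : setLang.Formula α, ∀ v, φ.Realize v ↔ P v

namespace Expressible

variable {P Q : (α → Rank lam) → Prop}

/-- The form in which elementarity is used throughout: a property is transferred once it is
assembled from the closure rules below, which mirror the formation of formulas. -/
theorem map_iff (h : Expressible P) (e : Rank lam ↪ₑ[setLang] Rank lam) (v : α → Rank lam) :
    P (fun i => e (v i)) ↔ P v := by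
  obtain ⟨φ, hφ⟩ := h
  rw [← hφ, ← hφ]
  exact e.map_formula φ v

theorem congr (h : Expressible P) (hPQ : ∀ v, Q v ↔ P v) : Expressible Q := by
  obtain ⟨φ, hφ⟩ := h
  exact ⟨φ, fun v => (hφ v).trans (hPQ v).symm⟩

theorem mem (i j : α) : Expressible fun v : α → Rank lam => (v i).1 ∈ (v j).1 :=
  ⟨Language.Relations.formula₂ (show setLang.Relations 2 from MemRel.mem) (.var i) (.var j),
    fun _ => Language.Formula.realize_rel₂⟩

theorem eq (i j : α) : Expressible fun v : α → Rank lam => v i = v j :=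
  ⟨Language.Term.equal (.var i) (.var j), fun v => by
    rw [Language.Formula.realize_equal]; rfl⟩

theorem not (h : Expressible P) : Expressible fun v => ¬ P v := by
  obtain ⟨φ, hφ⟩ := h
  exact ⟨φ.not, fun v => by rw [Language.Formula.realize_not, hφ]⟩

theorem and (h : Expressible P) (h' : Expressible Q) : Expressible fun v => P v ∧ Q v := by
  obtain ⟨φ, hφ⟩ := h
  obtain ⟨ψ, hψ⟩ := h'
  exact ⟨φ ⊓ ψ, fun v => by rw [Language.Formula.realize_inf, hφ, hψ]⟩

theorem or (h : Expressible P) (h' : Expressible Q) : Expressible fun v => P v ∨ Q v := by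
  obtain ⟨φ, hφ⟩ := h
  obtain ⟨ψ, hψ⟩ := h'
  exact ⟨φ ⊔ ψ, fun v => by rw [Language.Formula.realize_sup, hφ, hψ]⟩

theorem imp (h : Expressible P) (h' : Expressible Q) : Expressible fun v => P v → Q v := by
  obtain ⟨φ, hφ⟩ := h
  obtain ⟨ψ, hψ⟩ := h'
  exact ⟨φ.imp ψ, fun v => by rw [Language.Formula.realize_imp, hφ, hψ]⟩

theorem iff (h : Expressible P) (h' : Expressible Q) : Expressible fun v => P v ↔ Q v :=
  ((h.imp h').and (h'.imp h)).congr fun _ => iff_def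

theorem comp (h : Expressible P) (σ : α → β) :
    Expressible fun v : β → Rank lam => P (fun i => v (σ i)) := by
  obtain ⟨φ, hφ⟩ := h
  exact ⟨φ.relabel σ, fun v => by rw [Language.Formula.realize_relabel, hφ]; rfl⟩

theorem forall_tuple [Finite β] {R : (α → Rank lam) → (β → Rank lam) → Prop}
    (h : Expressible fun w : α ⊕ β → Rank lam => R (fun i => w (.inl i)) (fun i => w (.inr i))) :
    Expressible fun v => ∀ x, R v x := by
  obtain ⟨φ, hφ⟩ := h
  refine ⟨φ.iAlls β, fun v => ?_⟩
  rw [Language.Formula.realize_iAlls]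
  exact forall_congr' fun x => hφ _

theorem all {R : (α → Rank lam) → Rank lam → Prop}
    (h : Expressible fun w : α ⊕ Unit → Rank lam => R (fun i => w (.inl i)) (w (.inr ()))) :
    Expressible fun v => ∀ x, R v x :=
  (forall_tuple (β := Unit) (R := fun v x => R v (x ())) h).congr fun _ =>
    ⟨fun H x => H (x ()), fun H x => H fun _ => x⟩

theorem ex {R : (α → Rank lam) → Rank lam → Prop}
    (h : Expressible fun w : α ⊕ Unit → Rank lam => R (fun i => w (.inl i)) (w (.inr ()))) :
    Expressible fun v => ∃ x, R v x :=
  (all (R := fun v x => ¬ R v x) h.not).not.congr fun _ => by push Not; rfl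

theorem forall_fin [Finite β] {R : β → (α → Rank lam) → Prop} (h : ∀ i, Expressible (R i)) :
    Expressible fun v => ∀ i, R i v := by
  choose φ hφ using h
  exact ⟨Language.Formula.iInf φ, fun v => by simp only [Language.Formula.realize_iInf, hφ]⟩

end Expressible

theorem mem_rank_of_mem {x : ZFSet.{u}} {y : Rank lam} (h : x ∈ y.1) : x ∈ V_ lam :=
  (isTransitive_vonNeumann lam).mem_trans h y.2

/-- Bounded quantifiers are absolute because `V_lam` is transitive. -/
theorem exists_mem_rank {y : Rank lam} {p : ZFSet.{u} → Prop} :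
    (∃ x : Rank lam, x.1 ∈ y.1 ∧ p x.1) ↔ ∃ x ∈ y.1, p x :=
  ⟨fun ⟨x, h⟩ => ⟨x.1, h⟩, fun ⟨x, h, hp⟩ => ⟨⟨x, mem_rank_of_mem h⟩, h, hp⟩⟩

theorem forall_mem_rank {y : Rank lam} {p : ZFSet.{u} → Prop} :
    (∀ x : Rank lam, x.1 ∈ y.1 → p x.1) ↔ ∀ x ∈ y.1, p x :=
  ⟨fun H x h => H ⟨x, mem_rank_of_mem h⟩ h, fun H x h => H x.1 h⟩

theorem rank_ext {x y : Rank lam} (h : ∀ z : Rank lam, z.1 ∈ x.1 ↔ z.1 ∈ y.1) : x = y :=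
  Subtype.ext <| ZFSet.ext fun z =>
    ⟨fun hz => (h ⟨z, mem_rank_of_mem hz⟩).1 hz, fun hz => (h ⟨z, mem_rank_of_mem hz⟩).2 hz⟩

/-! ### Absoluteness of the basic set-theoretic notions -/

namespace Expressible

theorem subset (i j : α) : Expressible fun v : α → Rank lam => (v i).1 ⊆ (v j).1 := by
  refine congr (all (R := fun v x => x.1 ∈ (v i).1 → x.1 ∈ (v j).1) (imp (mem _ _) (mem _ _))) ?_
  intro v
  exact forall_mem_rank.symm

/-- `v i = {v j, v k}` -/
theorem eq_upair (i j k : α) :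
    Expressible fun v : α → Rank lam => (v i).1 = {(v j).1, (v k).1} := by
  refine congr (P := fun v => (v j).1 ∈ (v i).1 ∧ (v k).1 ∈ (v i).1 ∧
    ∀ x : Rank lam, x.1 ∈ (v i).1 → x = v j ∨ x = v k) ?_ ?_
  · exact and (mem _ _) (and (mem _ _) (all (imp (mem _ _) (or (eq _ _) (eq _ _)))))
  · intro v
    constructor
    · intro h
      refine ⟨h ▸ mem_pair.2 (.inl rfl), h ▸ mem_pair.2 (.inr rfl), fun x hx => ?_⟩
      exact (mem_pair.1 (h ▸ hx)).imp Subtype.ext Subtype.ext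
    · rintro ⟨h₁, h₂, h₃⟩
      ext z
      rw [mem_pair]
      constructor
      · intro hz
        have := h₃ ⟨z, mem_rank_of_mem hz⟩ hz
        simpa [Subtype.ext_iff] using this
      · rintro (rfl | rfl) <;> assumption

theorem eq_pair (i j k : α) :
    Expressible fun v : α → Rank lam => (v i).1 = pair (v j).1 (v k).1 := by
  refine congr (P := fun v => ∃ s t : Rank lam, s.1 = {(v j).1, (v j).1} ∧
    t.1 = {(v j).1, (v k).1} ∧ (v i).1 = {s.1, t.1}) ?_ ?_
  · exact ex (ex (and (eq_upair _ _ _) (and (eq_upair _ _ _) (eq_upair _ _ _))))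
  · intro v
    constructor
    · intro h
      refine ⟨⟨{(v j).1, (v j).1}, ?_⟩, ⟨{(v j).1, (v k).1}, ?_⟩, rfl, rfl, ?_⟩
      · exact mem_rank_of_mem (y := v i) (by rw [h]; simp [pair])
      · exact mem_rank_of_mem (y := v i) (by rw [h]; simp [pair])
      · exact h.trans (by simp [pair])
    · rintro ⟨s, t, hs, ht, h⟩
      rw [h, hs, ht]; simp [pair]

theorem pair_mem (i j k : α) :
    Expressible fun v : α → Rank lam => pair (v i).1 (v j).1 ∈ (v k).1 := by
  refine congr (P := fun v => ∃ s : Rank lam, s.1 = pair (v i).1 (v j).1 ∧ s.1 ∈ (v k).1) ?_ ?_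
  · exact ex (and (eq_pair _ _ _) (mem _ _))
  · exact fun v => ⟨fun h => ⟨⟨_, mem_rank_of_mem h⟩, rfl, h⟩, fun ⟨s, hs, h⟩ => hs ▸ h⟩

theorem isTransitive (i : α) : Expressible fun v : α → Rank lam => (v i).1.IsTransitive := by
  refine congr (P := fun v => ∀ x : Rank lam, x.1 ∈ (v i).1 → x.1 ⊆ (v i).1)
    (all (imp (mem _ _) (subset _ _))) fun v => ?_
  exact (forall_mem_rank (p := fun x => x ⊆ (v i).1)).symm

theorem isOrdinal (i : α) : Expressible fun v : α → Rank lam => (v i).1.IsOrdinal := by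
  refine congr (P := fun v => (v i).1.IsTransitive ∧
    ∀ x : Rank lam, x.1 ∈ (v i).1 → x.1.IsTransitive)
    (and (isTransitive _) (all (imp (mem _ _) (isTransitive _)))) fun v => ?_
  rw [isOrdinal_iff_forall_mem_isTransitive, forall_mem_rank (p := fun x => x.IsTransitive)]

end Expressible

end RankToRank

namespace RankToRank

open FirstOrder ZFSet

variable {lam : Ordinal.{u}} {α β : Type}

/-! ### Closure properties of `V_lam` -/

theorem pair_mem_vonNeumann {o : Ordinal.{u}} (ho : Order.IsSuccLimit o) {x y : ZFSet.{u}}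
    (hx : x ∈ V_ o) (hy : y ∈ V_ o) : pair x y ∈ V_ o := by
  rw [mem_vonNeumann] at *
  have h := ho.succ_lt (ho.succ_lt (max_lt hx hy))
  refine lt_of_le_of_lt ?_ h
  simp only [pair, rank_insert, rank_singleton, max_le_iff, Order.succ_le_succ_iff]
  simp

/-- The set `V_a` as an element of `V_lam`. -/
noncomputable def level (a : Ordinal.{u}) (h : a < lam) : Rank lam :=
  ⟨V_ a, vonNeumann_mem_of_lt h⟩

/-- The von Neumann ordinal `a` as an element of `V_lam`. -/
noncomputable def ord (a : Ordinal.{u}) (h : a < lam) : Rank lam :=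
  ⟨a.toZFSet, by rwa [mem_vonNeumann, Ordinal.rank_toZFSet]⟩

theorem rank_lt (x : Rank lam) : x.1.rank < lam := mem_vonNeumann.1 x.2

/-! ### Levels of the cumulative hierarchy -/

theorem eq_vonNeumann_rank_of_forall_mem_iff {x s : ZFSet.{u}}
    (hx : ∀ y, y ∈ x ↔ ∃ z ∈ s, y ⊆ z) (hs : ∀ z ∈ s, z = V_ z.rank) : x = V_ x.rank := by
  ext y
  rw [mem_vonNeumann, lt_rank_iff]
  refine ⟨fun hy => ⟨y, hy, le_rfl⟩, ?_⟩
  rintro ⟨w, hw, hyw⟩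
  obtain ⟨z, hz, hwz⟩ := (hx w).1 hw
  refine (hx y).2 ⟨z, hz, ?_⟩
  rw [hs z hz, subset_vonNeumann]
  exact hyw.trans (rank_mono hwz)

/-- Each element of `s` is the set of all subsets of those elements of `s` that it contains. -/
def IsHistory (s : ZFSet.{u}) : Prop :=
  ∀ x ∈ s, ∀ y, y ∈ x ↔ ∃ z ∈ s, z ∈ x ∧ y ⊆ z

theorem IsHistory.eq_vonNeumann_rank {s : ZFSet.{u}} (hs : IsHistory s) {x : ZFSet.{u}}
    (hx : x ∈ s) : x = V_ x.rank := by
  induction x using ZFSet.inductionOn with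
  | h x ih =>
    refine eq_vonNeumann_rank_of_forall_mem_iff (s := s ∩ x) (fun y => ?_) fun z hz => ?_
    · rw [hs x hx y]; simp [and_assoc]
    · rw [mem_inter] at hz
      exact ih z hz.2 hz.1

theorem exists_history (a : Ordinal.{u}) :
    ∃ s, s ⊆ V_ a ∧ IsHistory s ∧ ∀ y, y ∈ V_ a ↔ ∃ z ∈ s, y ⊆ z := by
  refine ⟨ZFSet.range fun b : Set.Iio a => V_ b.1, ?_, ?_, ?_⟩
  · intro x hx
    obtain ⟨b, rfl⟩ := mem_range.1 hx
    exact vonNeumann_mem_of_lt b.2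
  · intro x hx y
    obtain ⟨b, rfl⟩ := mem_range.1 hx
    simp only [mem_range, Subtype.exists, Set.mem_Iio, exists_prop, exists_exists_and_eq_and,
      vonNeumann_mem_vonNeumann_iff]
    rw [mem_vonNeumann']
    exact ⟨fun ⟨c, hc, h⟩ => ⟨c, hc.trans b.2, hc, h⟩, fun ⟨c, _, hc, h⟩ => ⟨c, hc, h⟩⟩
  · intro y
    simp [mem_vonNeumann']

/-- Being a level of the hierarchy is witnessed by a history, the set of all earlier levels. For `x
= V_a` that set is a subset of `x`, so it is available in `V_lam` and no replacement is needed
there. -/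
theorem exists_eq_vonNeumann_iff (x : Rank lam) :
    (∃ a, x.1 = V_ a) ↔ ∃ s : Rank lam,
      (∀ w : Rank lam, w.1 ∈ s.1 → ∀ y : Rank lam, y.1 ∈ w.1 ↔
        ∃ z : Rank lam, z.1 ∈ s.1 ∧ z.1 ∈ w.1 ∧ y.1 ⊆ z.1) ∧
      ∀ y : Rank lam, y.1 ∈ x.1 ↔ ∃ z : Rank lam, z.1 ∈ s.1 ∧ y.1 ⊆ z.1 := by
  constructor
  · rintro ⟨a, ha⟩
    obtain ⟨s, hs, hs', h⟩ := exists_history a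
    refine ⟨⟨s, mem_vonNeumann_of_subset (ha ▸ hs) x.2⟩, ?_, ?_⟩
    · intro w hw y
      rw [exists_mem_rank (p := fun z => z ∈ w.1 ∧ y.1 ⊆ z)]
      exact hs' _ hw _
    · intro y
      rw [exists_mem_rank (p := fun z => y.1 ⊆ z)]
      exact (iff_of_eq (congrArg (y.1 ∈ ·) ha)).trans (h _)
  · rintro ⟨s, hs, h⟩
    have hist : IsHistory s.1 := by
      intro w hw y
      constructor
      · intro hy
        obtain ⟨z, h⟩ := (hs ⟨w, mem_rank_of_mem hw⟩ hw
          ⟨y, mem_rank_of_mem (y := ⟨w, mem_rank_of_mem hw⟩) hy⟩).1 hy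
        exact ⟨z.1, h⟩
      · rintro ⟨z, hz, hzw, hyz⟩
        have hz' := mem_rank_of_mem hz
        exact (hs ⟨w, mem_rank_of_mem hw⟩ hw ⟨y, mem_vonNeumann_of_subset hyz hz'⟩).2
          ⟨⟨z, hz'⟩, hz, hzw, hyz⟩
    refine ⟨_, eq_vonNeumann_rank_of_forall_mem_iff (s := s.1) (fun y => ?_)
      fun z hz => hist.eq_vonNeumann_rank hz⟩
    constructor
    · intro hy
      obtain ⟨z, h⟩ := (h ⟨y, mem_rank_of_mem hy⟩).1 hy
      exact ⟨z.1, h⟩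
    · rintro ⟨z, hz, hyz⟩
      have hz' := mem_rank_of_mem hz
      exact (h ⟨y, mem_vonNeumann_of_subset hyz hz'⟩).2 ⟨⟨z, hz'⟩, hz, hyz⟩

namespace Expressible

theorem exists_eq_vonNeumann (i : α) :
    Expressible fun v : α → Rank lam => ∃ a, (v i).1 = V_ a := by
  refine congr ?_ fun v => exists_eq_vonNeumann_iff (v i)
  exact ex (and (all (imp (mem _ _) (all (iff (mem _ _)
    (ex (and (mem _ _) (and (mem _ _) (subset _ _))))))))
    (all (iff (mem _ _) (ex (and (mem _ _) (subset _ _))))))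

/-- The index of a level is recovered as the ordinal having the same ordinal elements as the level.
This lets one function `ordMap` describe the images of both `a` and `V_a`. -/
theorem eq_vonNeumann_of_ordinal (i j : α) :
    Expressible fun v : α → Rank lam => ∃ a, (v i).1 = V_ a ∧ (v j).1 = a.toZFSet := by
  refine congr (P := fun v => (∃ a, (v i).1 = V_ a) ∧ (v j).1.IsOrdinal ∧
    ∀ x : Rank lam, x.1.IsOrdinal → (x.1 ∈ (v i).1 ↔ x.1 ∈ (v j).1)) ?_ fun v => ?_
  · exact and (exists_eq_vonNeumann _) (and (isOrdinal _)
      (all (imp (isOrdinal _) (iff (mem _ _) (mem _ _)))))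
  · constructor
    · rintro ⟨a, hi, hj⟩
      refine ⟨⟨a, hi⟩, hj ▸ isOrdinal_toZFSet a, fun x hx => ?_⟩
      rw [hi, hj, mem_vonNeumann, ← hx.rank_lt_iff_mem (isOrdinal_toZFSet a),
        Ordinal.rank_toZFSet]
    · rintro ⟨⟨a, hi⟩, hj, h⟩
      refine ⟨a, hi, ZFSet.ext fun x => ?_⟩
      have ha : a < lam := by have := rank_lt (v i); rwa [hi, rank_vonNeumann] at this
      constructor
      · intro hx
        have hx' := hj.mem hx
        have := (h ⟨x, mem_rank_of_mem hx⟩ hx').2 hx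
        rw [hi, mem_vonNeumann] at this
        rw [← hx'.rank_lt_iff_mem (isOrdinal_toZFSet a), Ordinal.rank_toZFSet]
        exact this
      · intro hx
        obtain ⟨b, hb, rfl⟩ := Ordinal.mem_toZFSet_iff.1 hx
        refine (h (ord b (hb.trans ha)) (isOrdinal_toZFSet b)).1 ?_
        rw [hi, mem_vonNeumann]
        simpa [ord] using hb

theorem eq_insert_self (i j : α) :
    Expressible fun v : α → Rank lam => (v i).1 = insert (v j).1 (v j).1 := by
  refine congr (P := fun v => (v j).1 ∈ (v i).1 ∧ (v j).1 ⊆ (v i).1 ∧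
    ∀ x : Rank lam, x.1 ∈ (v i).1 → x = v j ∨ x.1 ∈ (v j).1) ?_ fun v => ?_
  · exact and (mem _ _) (and (subset _ _) (all (imp (mem _ _) (or (eq _ _) (mem _ _)))))
  · constructor
    · intro h
      refine ⟨h ▸ mem_insert _ _, h ▸ fun x hx => mem_insert_of_mem _ hx, fun x hx => ?_⟩
      exact (mem_insert_iff.1 (h ▸ hx)).imp_left Subtype.ext
    · rintro ⟨h₁, h₂, h₃⟩
      ext z
      rw [mem_insert_iff]
      constructor
      · intro hz
        exact (h₃ ⟨z, mem_rank_of_mem hz⟩ hz).imp_left (congrArg Subtype.val)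
      · rintro (rfl | h)
        exacts [h₁, h₂ h]

end Expressible

/-! ### The action of an elementary embedding on the ordinals -/

section ordMap

variable (e : Rank lam ↪ₑ[setLang] Rank lam)

theorem map_mem_iff (x y : Rank lam) : (e x).1 ∈ (e y).1 ↔ x.1 ∈ y.1 :=
  (Expressible.mem 0 1).map_iff e ![x, y]

theorem map_subset_iff (x y : Rank lam) : (e x).1 ⊆ (e y).1 ↔ x.1 ⊆ y.1 :=
  (Expressible.subset 0 1).map_iff e ![x, y]

theorem pair_map_mem_iff (x y z : Rank lam) :
    pair (e x).1 (e y).1 ∈ (e z).1 ↔ pair x.1 y.1 ∈ z.1 :=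
  (Expressible.pair_mem 0 1 2).map_iff e ![x, y, z]

/-- The ordinal to which the ordinal `a` is mapped; zero if `lam ≤ a`. -/
noncomputable def ordMap (a : Ordinal.{u}) : Ordinal.{u} :=
  if h : a < lam then (e (ord a h)).1.rank else 0

variable {a b : Ordinal.{u}}

theorem ordMap_spec (h : a < lam) :
    (e (level a h)).1 = V_ (ordMap e a) ∧ (e (ord a h)).1 = (ordMap e a).toZFSet := by
  obtain ⟨b, hb, hb'⟩ := ((Expressible.eq_vonNeumann_of_ordinal 0 1).map_iff e
    ![level a h, ord a h]).2 ⟨a, rfl, rfl⟩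
  have hab : ordMap e a = b := by
    have : (e (ord a h)).1 = b.toZFSet := hb'
    rw [ordMap, dif_pos h, this, Ordinal.rank_toZFSet]
  rw [hab]
  exact ⟨hb, hb'⟩

theorem map_level (h : a < lam) : (e (level a h)).1 = V_ (ordMap e a) := (ordMap_spec e h).1

theorem map_ord (h : a < lam) : (e (ord a h)).1 = (ordMap e a).toZFSet := (ordMap_spec e h).2

theorem ordMap_lt (h : a < lam) : ordMap e a < lam := by
  have := rank_lt (e (ord a h))
  rwa [map_ord, Ordinal.rank_toZFSet] at this

theorem map_ord_eq (h : a < lam) : e (ord a h) = ord (ordMap e a) (ordMap_lt e h) :=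
  Subtype.ext (map_ord e h)

theorem ordMap_lt_ordMap (ha : a < lam) (hb : b < lam) : ordMap e a < ordMap e b ↔ a < b := by
  have := map_mem_iff e (ord a ha) (ord b hb)
  rw [map_ord, map_ord] at this
  simpa [ord] using this

theorem ordMap_le_ordMap (ha : a < lam) (hb : b < lam) : ordMap e a ≤ ordMap e b ↔ a ≤ b :=
  le_iff_le_iff_lt_iff_lt.2 (ordMap_lt_ordMap e hb ha)

theorem le_ordMap (h : a < lam) : a ≤ ordMap e a := by
  induction a using WellFoundedLT.induction with
  | _ a ih =>
    refine le_of_forall_lt fun b hb => ?_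
    exact (ih b hb (hb.trans h)).trans_lt ((ordMap_lt_ordMap e (hb.trans h) h).2 hb)

theorem ordMap_zero (h : 0 < lam) : ordMap e 0 = 0 := by
  by_contra h0
  have h1 : (0 : Ordinal.{u}) < ordMap e 0 := pos_iff_ne_zero.2 h0
  have := ((Expressible.ex (R := fun v x => x.1 ∈ (v 0).1) (Expressible.mem _ _)).map_iff e
    ![ord 0 h]).1 ⟨ord 0 h, by
      show Ordinal.toZFSet 0 ∈ (e (ord 0 h)).1
      rw [map_ord]; exact Ordinal.toZFSet_mem_toZFSet_iff.2 h1⟩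
  obtain ⟨x, hx⟩ := this
  have hx : x.1 ∈ Ordinal.toZFSet 0 := hx
  simp at hx

theorem ordMap_add_one (h : a < lam) (h' : a + 1 < lam) : ordMap e (a + 1) = ordMap e a + 1 := by
  have := ((Expressible.eq_insert_self 0 1).map_iff e ![ord (a + 1) h', ord a h]).2
    (Ordinal.toZFSet_add_one a)
  have : (e (ord (a + 1) h')).1 = insert (e (ord a h)).1 (e (ord a h)).1 := this
  rw [map_ord, map_ord, ← Ordinal.toZFSet_add_one] at this
  exact Ordinal.toZFSet_injective this

/-- A set is fixed if all ordinals up to its rank are. -/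
theorem map_eq_self {x : Rank lam} (h : ∀ a ≤ x.1.rank, ordMap e a = a) : e x = x := by
  induction hr : x.1.rank using WellFoundedLT.induction generalizing x with
  | _ r ih =>
    subst hr
    have key : ∀ y : Rank lam, y.1.rank < x.1.rank → e y = y := fun y hy =>
      ih _ hy (fun a ha => h a (ha.trans hy.le)) rfl
    -- The level indexed by the rank of `x` is fixed, so `e x` gains no element of larger rank, and
    -- the elements it has are fixed by induction.
    have hsub : (e x).1 ⊆ V_ x.1.rank := by
      have := (map_subset_iff e x (level x.1.rank (rank_lt x))).2 (subset_vonNeumann.2 le_rfl)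
      rwa [map_level, h _ le_rfl] at this
    refine rank_ext fun z => ⟨fun hz => ?_, fun hz => ?_⟩
    · rw [← map_mem_iff e, key z (mem_vonNeumann.1 (hsub hz))]
      exact hz
    · rw [← key z (rank_lt_of_mem hz), map_mem_iff]
      exact hz

end ordMap

end RankToRank

namespace RankToRank

open FirstOrder ZFSet

variable {lam : Ordinal.{u}} {α β : Type}

/-! ### Graphs and critical points -/

theorem pair_mem_graph {f : Rank lam → Rank lam} {x y : ZFSet.{u}} :
    pair x y ∈ graph f ↔ ∃ h : x ∈ V_ lam, (f ⟨x, h⟩).1 = y := by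
  simp only [graph, mem_range, pair_inj]
  constructor
  · rintro ⟨z, rfl, h⟩
    exact ⟨z.2, h⟩
  · rintro ⟨h, h'⟩
    exact ⟨⟨x, h⟩, rfl, h'⟩

theorem pair_mem_graph_iff {f : Rank lam → Rank lam} {x y : Rank lam} :
    pair x.1 y.1 ∈ graph f ↔ f x = y := by
  rw [pair_mem_graph]
  exact ⟨fun ⟨_, h⟩ => Subtype.ext h, fun h => ⟨x.2, congrArg _ h⟩⟩

theorem val_eq {f x y : ZFSet.{u}} (hy : pair x y ∈ f) (h : ∀ z, pair x z ∈ f → z = y) :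
    val f x = y := by
  have : (⋃₀ (⋃₀ f : ZFSet.{u}) : ZFSet.{u}).sep (fun y => pair x y ∈ f) = {y} := by
    ext z
    rw [mem_sep, mem_singleton]
    refine ⟨fun hz => h z hz.2, ?_⟩
    rintro rfl
    refine ⟨mem_sUnion.2 ⟨{x, z}, mem_sUnion.2 ⟨_, hy, ?_⟩, ?_⟩, hy⟩ <;> simp [pair]
  rw [val, this, sUnion_singleton]

theorem val_eq_empty {f x : ZFSet.{u}} (h : ∀ z, pair x z ∉ f) : val f x = ∅ := by
  have : (⋃₀ (⋃₀ f : ZFSet.{u}) : ZFSet.{u}).sep (fun y => pair x y ∈ f) = ∅ := by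
    rw [eq_empty]
    exact fun z hz => h z (mem_sep.1 hz).2
  rw [val, this, sUnion_empty]

theorem val_graph (f : Rank lam → Rank lam) (x : Rank lam) : val (graph f) x.1 = (f x).1 := by
  refine val_eq (pair_mem_graph_iff.2 rfl) fun z hz => ?_
  obtain ⟨_, h⟩ := pair_mem_graph.1 hz
  exact h.symm

theorem mem_rng_graph {f : Rank lam → Rank lam} {y : ZFSet.{u}} :
    y ∈ rng (graph f) ↔ ∃ x, (f x).1 = y := by
  simp only [rng, Set.mem_ofPred_eq, pair_mem_graph]
  exact ⟨fun ⟨x, h, h'⟩ => ⟨⟨x, h⟩, h'⟩, fun ⟨x, h⟩ => ⟨x.1, x.2, h⟩⟩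

section crit

variable (e : Rank lam ↪ₑ[setLang] Rank lam)

theorem mem_val_graph_iff (a : Ordinal.{u}) :
    a.toZFSet ∈ val (graph e) a.toZFSet ↔ a < lam ∧ a < ordMap e a := by
  by_cases h : a < lam
  · have := val_graph e (ord a h)
    rw [map_ord] at this
    have : val (graph e) a.toZFSet = (ordMap e a).toZFSet := this
    simp [this, h]
  · rw [val_eq_empty]
    · simp [h]
    · intro z hz
      obtain ⟨h', -⟩ := pair_mem_graph.1 hz
      rw [mem_vonNeumann, Ordinal.rank_toZFSet] at h'
      exact h h'

variable {e}

/-- Some ordinal is moved, for otherwise `map_eq_self` would fix every set; so the infimum is not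
over the empty set. -/
theorem crit_spec (he : ∃ x, e x ≠ x) :
    crit (graph e) < lam ∧ crit (graph e) < ordMap e (crit (graph e)) := by
  rw [← mem_val_graph_iff]
  refine csInf_mem (s := {κ : Ordinal.{u} | κ.toZFSet ∈ val (graph e) κ.toZFSet}) ?_
  obtain ⟨x, hx⟩ := he
  by_contra hne
  refine hx (map_eq_self e fun a ha => ?_)
  have hal := ha.trans_lt (rank_lt x)
  by_contra h
  exact hne ⟨a, (mem_val_graph_iff e a).2 ⟨hal, lt_of_le_of_ne (le_ordMap e hal) (Ne.symm h)⟩⟩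

theorem crit_lt (he : ∃ x, e x ≠ x) : crit (graph e) < lam := (crit_spec he).1

theorem crit_lt_ordMap (he : ∃ x, e x ≠ x) : crit (graph e) < ordMap e (crit (graph e)) :=
  (crit_spec he).2

theorem ordMap_of_lt_crit (he : ∃ x, e x ≠ x) {a : Ordinal.{u}} (h : a < crit (graph e)) :
    ordMap e a = a := by
  have hal := h.trans (crit_lt he)
  by_contra hne
  refine notMem_of_lt_csInf' h ((mem_val_graph_iff e a).2 ⟨hal, ?_⟩)
  exact lt_of_le_of_ne (le_ordMap e hal) (Ne.symm hne)

theorem map_of_rank_lt_crit (he : ∃ x, e x ≠ x) {x : Rank lam} (h : x.1.rank < crit (graph e)) :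
    e x = x :=
  map_eq_self e fun _ ha => ordMap_of_lt_crit he (ha.trans_lt h)

theorem ordMap_natCast (hlam : Order.IsSuccLimit lam) (n : ℕ) :
    ordMap e n = n := by
  have hω := Ordinal.omega0_le_of_isSuccLimit hlam
  have hn : ∀ n : ℕ, (n : Ordinal.{u}) < lam := fun n => (Ordinal.natCast_lt_omega0 n).trans_le hω
  induction n with
  | zero => simpa using ordMap_zero e (by simpa using hn 0)
  | succ n ih =>
    have := ordMap_add_one e (hn n) (by simpa using hn (n + 1))
    rw [ih] at this
    simpa using this

/-- Natural numbers are fixed. If `ω` were moved it would be an element of `e(ω)`, all of whose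
nonempty elements are successors by elementarity. Consequently `e` acts termwise on `ω`-sequences.
-/
theorem omega0_lt_crit (hlam : Order.IsSuccLimit lam) (he : ∃ x, e x ≠ x) :
    Ordinal.omega0 < crit (graph e) := by
  have hle : Ordinal.omega0 ≤ crit (graph e) := by
    by_contra! h
    obtain ⟨n, hn⟩ := Ordinal.lt_omega0.1 h
    have := crit_lt_ordMap he
    rw [hn, ordMap_natCast hlam] at this
    exact lt_irrefl _ this
  refine lt_of_le_of_ne hle fun heq => ?_
  have hω : Ordinal.omega0 < lam := heq ▸ crit_lt he
  have hmv : Ordinal.omega0 < ordMap e Ordinal.omega0 := heq ▸ crit_lt_ordMap he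
  -- every nonempty element of `ω` has the form `insert y y`
  have hE : Expressible fun v : Fin 1 → Rank lam => ∀ x z : Rank lam,
      x.1 ∈ (v 0).1 → z.1 ∈ x.1 → ∃ y : Rank lam, x.1 = insert y.1 y.1 :=
    .all (.all (.imp (.mem _ _) (.imp (.mem _ _) (.ex (.eq_insert_self _ _)))))
  have hω' : ∀ x z : Rank lam, x.1 ∈ (ord Ordinal.omega0 hω).1 → z.1 ∈ x.1 →
      ∃ y : Rank lam, x.1 = insert y.1 y.1 := by
    intro x z hx hz
    obtain ⟨a, ha, hax⟩ := Ordinal.mem_toZFSet_iff.1 hx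
    obtain ⟨n, rfl⟩ := Ordinal.lt_omega0.1 ha
    cases n with
    | zero => rw [← hax] at hz; simp at hz
    | succ n =>
      refine ⟨ord n ((Ordinal.natCast_lt_omega0 n).trans hω), ?_⟩
      rw [← hax, Nat.cast_succ, Ordinal.toZFSet_add_one]
      rfl
  have h := (hE.map_iff e ![ord Ordinal.omega0 hω]).2 hω' (ord Ordinal.omega0 hω)
    (ord 0 (Ordinal.omega0_pos.trans hω)) (by
      show Ordinal.toZFSet Ordinal.omega0 ∈ (e (ord Ordinal.omega0 hω)).1
      rw [map_ord]
      exact Ordinal.toZFSet_mem_toZFSet_iff.2 hmv)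
    (Ordinal.toZFSet_mem_toZFSet_iff.2 Ordinal.omega0_pos)
  obtain ⟨y, hy⟩ := h
  have hy : Ordinal.omega0.toZFSet = insert y.1 y.1 := hy
  have hy' : y.1 ∈ Ordinal.omega0.toZFSet := hy ▸ mem_insert _ _
  obtain ⟨b, hb, hby⟩ := Ordinal.mem_toZFSet_iff.1 hy'
  rw [← hby, ← Ordinal.toZFSet_add_one] at hy
  have := Ordinal.toZFSet_injective hy
  exact (Ordinal.isSuccLimit_omega0.add_one_lt hb).ne this.symm

end crit

/-! ### Application of embeddings -/

/-- The part of the graph of `f` in `V_a`. -/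
noncomputable def graphPart (f : Rank lam → Rank lam) (a : Ordinal.{u}) (h : a < lam) : Rank lam :=
  ⟨graph f ∩ V_ a, mem_vonNeumann_of_subset (fun _ hx => (mem_inter.1 hx).2)
    (vonNeumann_mem_of_lt h)⟩

theorem mem_app_graph {e f : Rank lam → Rank lam} {z : ZFSet.{u}} :
    z ∈ app lam (graph e) (graph f) ↔ ∃ (a : Ordinal.{u}) (h : a < lam),
      z ∈ (e (graphPart f a h)).1 := by
  have hval : ∀ a (h : a < lam), val (graph e) (graph f ∩ V_ a) = (e (graphPart f a h)).1 :=
    fun a h => val_graph e (graphPart f a h)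
  simp only [app, mem_iUnion, Subtype.exists]
  exact ⟨fun ⟨a, h, hz⟩ => ⟨a, h, hval a h ▸ hz⟩, fun ⟨a, h, hz⟩ => ⟨a, h, (hval a h).symm ▸ hz⟩⟩

section application

variable {e f : Rank lam ↪ₑ[setLang] Rank lam}

theorem graphPart_mono {a b : Ordinal.{u}} (ha : a < lam) (hb : b < lam) (hab : a ≤ b) :
    (e (graphPart f a ha)).1 ⊆ (e (graphPart f b hb)).1 := by
  rw [map_subset_iff]
  intro x hx
  obtain ⟨h1, h2⟩ := mem_inter.1 hx
  exact mem_inter.2 ⟨h1, vonNeumann_subset_of_le hab h2⟩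

theorem exists_eq_pair_of_mem_app {z : ZFSet.{u}} (hz : z ∈ app lam (graph e) (graph f)) :
    ∃ x y : Rank lam, z = pair x.1 y.1 := by
  obtain ⟨a, ha, hz⟩ := mem_app_graph.1 hz
  have hE : Expressible fun v : Fin 1 → Rank lam => ∀ z : Rank lam, z.1 ∈ (v 0).1 →
      ∃ x y : Rank lam, z.1 = pair x.1 y.1 :=
    .all (.imp (.mem _ _) (.ex (.ex (.eq_pair _ _ _))))
  refine (hE.map_iff e ![graphPart f a ha]).2 ?_ ⟨z, mem_rank_of_mem hz⟩ hz
  intro z hz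
  obtain ⟨x, hx⟩ := mem_range.1 (mem_inter.1 hz).1
  exact ⟨x, f x, hx.symm⟩

/-- Truth of an expressible predicate is preserved by the relation `app lam (graph e) (graph f)`. -/
theorem iff_of_pair_mem_app [Finite α] {P : (α → Rank lam) → Prop} (hP : Expressible P)
    {v w : α → Rank lam} (hvw : ∀ i, pair (v i).1 (w i).1 ∈ app lam (graph e) (graph f)) :
    P v ↔ P w := by
  -- The case `lam = 0` is split off because for an empty tuple some level below `lam` must still be
  -- named.
  by_cases hl : 0 < lam
  swap
  · have h0 : lam = 0 := by simpa using hl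
    have : IsEmpty (Rank lam) := ⟨fun x => by have := x.2; simp [h0] at this⟩
    rw [Subsingleton.elim v w]
  choose b hb hb' using fun i => mem_app_graph.1 (hvw i)
  obtain ⟨a, ha, hba⟩ : ∃ a < lam, ∀ i, b i ≤ a := by
    cases isEmpty_or_nonempty α
    · exact ⟨0, hl, fun i => isEmptyElim i⟩
    · obtain ⟨i, hi⟩ := Finite.exists_max b
      exact ⟨b i, hb i, hi⟩
  -- That a relation respects `P` is a first-order property of it; `f ∩ V_a` has it since `f` is
  -- elementary, hence so does its image under `e`.
  have hE : Expressible fun g : Fin 1 → Rank lam => ∀ v w : α → Rank lam,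
      (∀ i, pair (v i).1 (w i).1 ∈ (g 0).1) → (P v ↔ P w) :=
    .forall_tuple (.forall_tuple (.imp (.forall_fin fun i => .pair_mem _ _ _)
      (.iff (hP.comp _) (hP.comp _))))
  refine (hE.map_iff e ![graphPart f a ha]).2 ?_ v w fun i => graphPart_mono (hb i) ha (hba i) (hb' i)
  intro v w h
  have hw : w = fun i => f (v i) := funext fun i =>
    (pair_mem_graph_iff.1 (mem_inter.1 (h i)).1).symm
  rw [hw]
  exact (hP.map_iff f v).symm

theorem exists_pair_mem_app (hlam : Order.IsSuccLimit lam) (x : Rank lam) :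
    ∃ y : Rank lam, pair x.1 y.1 ∈ app lam (graph e) (graph f) := by
  -- choose `b` with `x ∈ V_b ⊆ e(V_b)` and `a` such that the graph of `f` on `V_b` is in `V_a`
  set b := Order.succ x.1.rank with hb
  have hbl : b < lam := hlam.succ_lt (rank_lt x)
  have hfb : ordMap f b < lam := ordMap_lt f hbl
  set a := Order.succ (Order.succ (max b (ordMap f b))) with ha
  have hal : a < lam := hlam.succ_lt (hlam.succ_lt (max_lt hbl hfb))
  have hE : Expressible fun v : Fin 2 → Rank lam => ∀ x : Rank lam, x.1 ∈ (v 0).1 →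
      ∃ y : Rank lam, pair x.1 y.1 ∈ (v 1).1 :=
    .all (.imp (.mem _ _) (.ex (.pair_mem _ _ _)))
  have := (hE.map_iff e ![level b hbl, graphPart f a hal]).2 ?_ x ?_
  · obtain ⟨y, hy⟩ := this
    exact ⟨y, mem_app_graph.2 ⟨a, hal, hy⟩⟩
  · intro x hx
    refine ⟨f x, mem_inter.2 ⟨pair_mem_graph_iff.2 rfl, ?_⟩⟩
    have h1 : x.1.rank < b := mem_vonNeumann.1 hx
    have h2 : (f x).1.rank < ordMap f b := by
      rw [← mem_vonNeumann, ← map_level f hbl, map_mem_iff]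
      exact hx
    rw [mem_vonNeumann, ha, pair, rank_pair, rank_pair, rank_singleton]
    have h3 := h1.trans_le (le_max_left b (ordMap f b))
    have h4 := h2.trans_le (le_max_right b (ordMap f b))
    simp only [max_lt_iff, Order.succ_lt_succ_iff]
    exact ⟨h3, h3, h4⟩
  · show x.1 ∈ (e (level b hbl)).1
    rw [map_level, mem_vonNeumann]
    exact (Order.lt_succ _).trans_le (le_ordMap e hbl)

/-- Both single-valuedness and elementarity are instances of `iff_of_pair_mem_app`, for equality and
for arbitrary formulas. Nontriviality comes from `g (e x) = e (f x)`: if `f` moves `x` then `g`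
moves `e x`. -/
theorem exists_embedding_app (hlam : Order.IsSuccLimit lam) (hf : ∃ x, f x ≠ x) :
    ∃ g : Rank lam ↪ₑ[setLang] Rank lam, (∃ x, g x ≠ x) ∧
      app lam (graph e) (graph f) = graph g := by
  choose g hg using exists_pair_mem_app (e := e) (f := f) hlam
  have huniq : ∀ x y : Rank lam, pair x.1 y.1 ∈ app lam (graph e) (graph f) → y = g x := by
    intro x y hy
    refine (iff_of_pair_mem_app (e := e) (f := f) (Expressible.eq (0 : Fin 2) 1)
      (v := ![x, x]) (w := ![y, g x]) ?_).1 rfl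
    intro i
    fin_cases i
    exacts [hy, hg x]
  let G : Rank lam ↪ₑ[setLang] Rank lam := ⟨g, fun n φ v => by
    exact (iff_of_pair_mem_app (P := φ.Realize) ⟨φ, fun _ => Iff.rfl⟩ fun i => hg (v i)).symm⟩
  refine ⟨G, ?_, ?_⟩
  · obtain ⟨x, hx⟩ := hf
    refine ⟨e x, fun h => hx ?_⟩
    obtain ⟨a, ha, hpa⟩ : ∃ a < lam, pair x.1 (f x).1 ∈ V_ a :=
      ⟨_, hlam.succ_lt (mem_vonNeumann.1 (pair_mem_vonNeumann hlam x.2 (f x).2)),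
        mem_vonNeumann_succ _⟩
    have : e (f x) = g (e x) := huniq _ _ (mem_app_graph.2 ⟨a, ha, (pair_map_mem_iff e _ _ _).2
      (mem_inter.2 ⟨pair_mem_graph_iff.2 rfl, hpa⟩)⟩)
    exact e.injective (this.trans h)
  · ext z
    constructor
    · intro hz
      obtain ⟨x, y, rfl⟩ := exists_eq_pair_of_mem_app hz
      exact pair_mem_graph_iff.2 (huniq x y hz).symm
    · intro hz
      obtain ⟨x, rfl⟩ := mem_range.1 hz
      exact hg x

end application

end RankToRank

/-! ### Cardinal arithmetic: the Erdős–Hajnal function -/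

namespace RankToRank

open Cardinal

/-- Sets at least as numerous as the index type have a system of distinct representatives. -/
theorem exists_injective_mem {ι T : Type u} (S : ι → Set T) (hS : ∀ i, #ι ≤ #(S i)) :
    ∃ s : ι → T, Function.Injective s ∧ ∀ i, s i ∈ S i := by
  -- In a well-order of least type each index has fewer than `#ι` predecessors, so a recursive
  -- choice can avoid all earlier values.
  obtain ⟨r, hr, hord⟩ := Cardinal.exists_ord_eq ι
  have hlt : ∀ i, #{j // r j i} < #ι := fun i => by
    have := Ordinal.typein_lt_type r i
    rw [← hord, Cardinal.lt_ord] at this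
    exact this
  have hwf : WellFounded r := hr.wf
  let step : ∀ i, (∀ j, r j i → T) → T := fun i prev =>
    haveI : Nonempty T := by
      have : #(S i) ≠ 0 := (pos_of_gt ((hlt i).trans_le (hS i))).ne'
      exact (Cardinal.mk_ne_zero_iff.1 this).map Subtype.val
    Classical.epsilon fun t => t ∈ S i ∧ ∀ j (h : r j i), t ≠ prev j h
  let s : ι → T := hwf.fix step
  have hs : ∀ i, s i ∈ S i ∧ ∀ j, r j i → s i ≠ s j := by
    intro i
    have hsi : s i = step i fun j _ => s j := hwf.fix_eq step i
    rw [hsi]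
    apply Classical.epsilon_spec (p := fun t => t ∈ S i ∧ ∀ j (h : r j i), t ≠ s j)
    by_contra! hne
    have hsub : S i ⊆ Set.range fun j : {j // r j i} => s j.1 := by
      intro t ht
      obtain ⟨j, hj, h⟩ := hne t ht
      exact ⟨⟨j, hj⟩, h.symm⟩
    exact ((hS i).trans ((Cardinal.mk_le_mk_of_subset hsub).trans Cardinal.mk_range_le)).not_gt
      (hlt i)
  refine ⟨s, fun i j hij => ?_, fun i => (hs i).1⟩
  by_contra hne
  rcases trichotomous_of r i j with h | h | h
  · exact (hs j).2 i h hij.symm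
  · exact hne h
  · exact (hs i).2 j h hij

/-- If there are at least as many sequences in `X` as subsets of `X`, then some function on the
sequences takes every value on the sequences from the range of any injection. -/
theorem exists_jonsson_function {X : Type u} [Infinite X] (hX : #(Set X) ≤ #(ℕ → X)) :
    ∃ F : (ℕ → X) → X, ∀ g : X → X, Function.Injective g → ∀ y, ∃ t : ℕ → X, F (g ∘ t) = y := by
  -- There are at most `2^X` pairs `(g, y)`, and each `g` has at least that many sequences `g ∘ t`.
  -- So distinct pairs get distinct sequences, and `F` sends the sequence chosen for `(g, y)` to
  -- `y`; elsewhere its value `t 0` is irrelevant.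
  let ι := {g : X → X // Function.Injective g} × X
  have hι : #ι ≤ #(ℕ → X) := by
    have h1 : #{g : X → X // Function.Injective g} ≤ 2 ^ #X := by
      refine (Cardinal.mk_subtype_le _).trans ?_
      rw [← Cardinal.power_def, Cardinal.power_self_eq (Cardinal.aleph0_le_mk X)]
    have h2 : #ι ≤ 2 ^ #X := by
      rw [Cardinal.mk_prod, Cardinal.lift_id, Cardinal.lift_id]
      refine (mul_le_mul' h1 (Cardinal.cantor _).le).trans ?_
      rw [Cardinal.mul_eq_self]
      exact (Cardinal.aleph0_le_mk X).trans (Cardinal.cantor _).le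
    exact h2.trans (by rwa [Cardinal.mk_set] at hX)
  obtain ⟨s, hs, hs'⟩ := exists_injective_mem
    (fun i : ι => Set.range fun t : ℕ → X => i.1.1 ∘ t) fun i => by
      rw [Cardinal.mk_range_eq _ i.1.2.comp_left]
      exact hι
  refine ⟨Function.extend s Prod.snd fun t => t 0, fun g hg y => ?_⟩
  obtain ⟨t, ht⟩ := hs' (⟨g, hg⟩, y)
  refine ⟨t, ?_⟩
  have ht : g ∘ t = s (⟨g, hg⟩, y) := ht
  rw [ht, hs.extend_apply]

/-- A subset of `X` is determined by its traces on the `S n`, each coded by one element of `X`. -/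
theorem mk_set_le_mk_seq {X : Type u} (S : ℕ → Set X) (hS : ∀ x, ∃ n, x ∈ S n)
    (hcard : ∀ n, #(Set (S n)) ≤ #X) : #(Set X) ≤ #(ℕ → X) := by
  have f : ∀ n, Set (S n) ↪ X := fun n => (hcard n).some
  refine ⟨⟨fun A n => f n {x | x.1 ∈ A}, fun A B h => ?_⟩⟩
  ext x
  obtain ⟨n, hn⟩ := hS x
  have := (f n).injective (congrFun h n)
  exact Set.ext_iff.1 this ⟨x, hn⟩

end RankToRank

namespace RankToRank

open FirstOrder ZFSet Cardinal

variable {lam : Ordinal.{u}}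

/-! ### Sequences of length `ω` -/

theorem pair_mem_vonNeumann_succ {a : Ordinal.{u}} {x y : ZFSet.{u}} (hx : x ∈ V_ a)
    (hy : y ∈ V_ a) : pair x y ∈ V_ (Order.succ (Order.succ a)) := by
  rw [mem_vonNeumann] at *
  rw [pair, rank_pair, rank_pair, rank_singleton]
  simp only [max_lt_iff, Order.succ_lt_succ_iff]
  exact ⟨hx, hx, hy⟩

/-- The function with domain `ω` and values `s n`. -/
noncomputable def seqSet (s : ℕ → ZFSet.{u}) : ZFSet.{u} :=
  ZFSet.range fun n : ℕ => pair (n : Ordinal.{u}).toZFSet (s n)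

theorem pair_mem_seqSet {s : ℕ → ZFSet.{u}} {x y : ZFSet.{u}} :
    pair x y ∈ seqSet s ↔ ∃ n : ℕ, x = (n : Ordinal.{u}).toZFSet ∧ y = s n := by
  simp only [seqSet, mem_range, pair_inj]
  exact exists_congr fun n => and_congr eq_comm eq_comm

theorem natCast_toZFSet_injective :
    Function.Injective fun n : ℕ => (n : Ordinal.{u}).toZFSet :=
  Ordinal.toZFSet_injective.comp Nat.cast_injective

theorem natCast_pair_mem_seqSet {s : ℕ → ZFSet.{u}} {n : ℕ} {y : ZFSet.{u}} :
    pair (n : Ordinal.{u}).toZFSet y ∈ seqSet s ↔ y = s n := by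
  rw [pair_mem_seqSet]
  constructor
  · rintro ⟨m, hm, hy⟩
    rw [natCast_toZFSet_injective hm, hy]
  · exact fun h => ⟨n, rfl, h⟩

theorem seqSet_subset {s : ℕ → ZFSet.{u}} {b : Ordinal.{u}} (hb : Ordinal.omega0 ≤ b)
    (hs : ∀ n, s n ∈ V_ b) : seqSet s ⊆ V_ (Order.succ (Order.succ b)) := by
  intro z hz
  obtain ⟨n, rfl⟩ := mem_range.1 hz
  refine pair_mem_vonNeumann_succ ?_ (hs n)
  rw [mem_vonNeumann, Ordinal.rank_toZFSet]
  exact (Ordinal.natCast_lt_omega0 n).trans_le hb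

theorem seqSet_mem {s : ℕ → ZFSet.{u}} {b : Ordinal.{u}} (hlam : Order.IsSuccLimit lam)
    (hb : Ordinal.omega0 ≤ b) (hbl : b < lam) (hs : ∀ n, s n ∈ V_ b) : seqSet s ∈ V_ lam :=
  mem_vonNeumann_of_subset (seqSet_subset hb hs)
    (vonNeumann_mem_of_lt (hlam.succ_lt (hlam.succ_lt hbl)))

section critical

variable {e : Rank lam ↪ₑ[setLang] Rank lam}

theorem natCast_lt_crit (hlam : Order.IsSuccLimit lam) (he : ∃ x, e x ≠ x) (n : ℕ) :
    (n : Ordinal.{u}) < crit (graph e) :=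
  (Ordinal.natCast_lt_omega0 n).trans (omega0_lt_crit hlam he)

theorem omega0_lt_of_exists_ne (hlam : Order.IsSuccLimit lam) (he : ∃ x, e x ≠ x) :
    Ordinal.omega0 < lam :=
  (omega0_lt_crit hlam he).trans (crit_lt he)

theorem map_ord_of_lt_crit (he : ∃ x, e x ≠ x) {a : Ordinal.{u}} (h : a < crit (graph e))
    (h' : a < lam) : e (ord a h') = ord a h' :=
  Subtype.ext (by rw [map_ord, ordMap_of_lt_crit he h]; rfl)

theorem map_seqSet (hlam : Order.IsSuccLimit lam) (he : ∃ x, e x ≠ x) (s : ℕ → Rank lam)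
    (hs : seqSet (fun n => (s n).1) ∈ V_ lam) :
    (e ⟨_, hs⟩).1 = seqSet fun n => (e (s n)).1 := by
  have hω := omega0_lt_of_exists_ne hlam he
  set t : Rank lam := ⟨_, hs⟩ with ht
  have hnl : ∀ n : ℕ, (n : Ordinal.{u}) < lam := fun n => (natCast_lt_crit hlam he n).trans
    (crit_lt he)
  have hE : Expressible fun v : Fin 2 → Rank lam => ∀ z : Rank lam, z.1 ∈ (v 0).1 →
      ∃ n y : Rank lam, n.1 ∈ (v 1).1 ∧ z.1 = pair n.1 y.1 :=
    .all (.imp (.mem _ _) (.ex (.ex (.and (.mem _ _) (.eq_pair _ _ _)))))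
  have hF : Expressible fun v : Fin 1 → Rank lam => ∀ n y z : Rank lam,
      pair n.1 y.1 ∈ (v 0).1 → pair n.1 z.1 ∈ (v 0).1 → y = z :=
    .all (.all (.all (.imp (.pair_mem _ _ _) (.imp (.pair_mem _ _ _) (.eq _ _)))))
  have hE' : ∀ z : Rank lam, z.1 ∈ (e t).1 →
      ∃ n y : Rank lam, n.1 ∈ (e (ord Ordinal.omega0 hω)).1 ∧ z.1 = pair n.1 y.1 := by
    refine (hE.map_iff e ![t, ord Ordinal.omega0 hω]).2 ?_
    intro z hz
    obtain ⟨n, hn⟩ := mem_range.1 hz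
    exact ⟨ord n (hnl n), s n,
      Ordinal.toZFSet_mem_toZFSet_iff.2 (Ordinal.natCast_lt_omega0 n), hn.symm⟩
  have hF' : ∀ n y z : Rank lam, pair n.1 y.1 ∈ (e t).1 → pair n.1 z.1 ∈ (e t).1 → y = z := by
    refine (hF.map_iff e ![t]).2 ?_
    intro n y z hy hz
    obtain ⟨m, hm, hy⟩ := pair_mem_seqSet.1 hy
    obtain ⟨k, hk, hz⟩ := pair_mem_seqSet.1 hz
    obtain rfl : m = k := natCast_toZFSet_injective (hm.symm.trans hk)
    exact Subtype.ext (hy.trans hz.symm)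
  have hval : ∀ n : ℕ, pair (n : Ordinal.{u}).toZFSet (e (s n)).1 ∈ (e t).1 := by
    intro n
    have := (pair_map_mem_iff e (ord n (hnl n)) (s n) t).2 (natCast_pair_mem_seqSet.2 rfl)
    rwa [map_ord_of_lt_crit he (natCast_lt_crit hlam he n)] at this
  ext z
  constructor
  · intro hz
    obtain ⟨n, y, hn, hzy⟩ := hE' ⟨z, mem_rank_of_mem hz⟩ hz
    rw [map_ord_of_lt_crit he (omega0_lt_crit hlam he)] at hn
    obtain ⟨a, ha, han⟩ := Ordinal.mem_toZFSet_iff.1 hn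
    obtain ⟨n, rfl⟩ := Ordinal.lt_omega0.1 ha
    have hzy : z = pair _ y.1 := hzy
    rw [← han] at hzy
    subst hzy
    exact natCast_pair_mem_seqSet.2 (congrArg Subtype.val
      (hF' (ord n (hnl n)) y (e (s n)) hz (hval n)))
  · intro hz
    obtain ⟨n, rfl⟩ := mem_range.1 hz
    exact hval n

/-! ### The critical sequence -/

variable (e) in
/-- The critical sequence `κ, e(κ), e(e(κ)), …` of the embedding `e`. -/
noncomputable def critSeq (n : ℕ) : Ordinal.{u} := (ordMap e)^[n] (crit (graph e))

theorem critSeq_succ (n : ℕ) : critSeq e (n + 1) = ordMap e (critSeq e n) :=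
  Function.iterate_succ_apply' _ _ _

theorem critSeq_lt (he : ∃ x, e x ≠ x) (n : ℕ) : critSeq e n < lam := by
  induction n with
  | zero => exact crit_lt he
  | succ n ih => rw [critSeq_succ]; exact ordMap_lt e ih

theorem critSeq_lt_succ (he : ∃ x, e x ≠ x) (n : ℕ) : critSeq e n < critSeq e (n + 1) := by
  induction n with
  | zero => exact crit_lt_ordMap he
  | succ n ih =>
    rw [critSeq_succ n, critSeq_succ (n + 1), ordMap_lt_ordMap e (critSeq_lt he _)
      (critSeq_lt he _)]
    exact ih

/-- No function maps the power set of an element of `k` onto `k`. -/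
def NoSurjection (k : Rank lam) : Prop :=
  ∀ c f : Rank lam, c.1 ∈ k.1 →
    (∀ a x y : Rank lam, pair a.1 x.1 ∈ f.1 → pair a.1 y.1 ∈ f.1 → x = y) →
    ¬ ∀ x : Rank lam, x.1 ∈ k.1 → ∃ a : Rank lam, a.1 ⊆ c.1 ∧ pair a.1 x.1 ∈ f.1

theorem expressible_noSurjection :
    Expressible fun v : Fin 1 → Rank lam => NoSurjection (v 0) :=
  .all (.all (.imp (.mem _ _) (.imp (.all (.all (.all (.imp (.pair_mem _ _ _)
    (.imp (.pair_mem _ _ _) (.eq _ _)))))) (.not (.all (.imp (.mem _ _)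
      (.ex (.and (.subset _ _) (.pair_mem _ _ _)))))))))

/-- If `f` mapped the power set of `c ∈ κ` onto `κ`, then `e(f)` would take the value `κ` at some `a
⊆ e(c) = c`. But `e` fixes `a` and a value `x ∈ κ` of `f` at `a`, so `e(f)` also takes the value `x`
at `a`, whence `x = κ`. -/
theorem noSurjection_crit (he : ∃ x, e x ≠ x) :
    NoSurjection (ord (crit (graph e)) (crit_lt he)) := by
  intro c f hc hf hsurj
  have hF : Expressible fun v : Fin 1 → Rank lam => ∀ n y z : Rank lam,
      pair n.1 y.1 ∈ (v 0).1 → pair n.1 z.1 ∈ (v 0).1 → y = z :=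
    .all (.all (.all (.imp (.pair_mem _ _ _) (.imp (.pair_mem _ _ _) (.eq _ _)))))
  have hS : Expressible fun v : Fin 3 → Rank lam => ∀ x : Rank lam, x.1 ∈ (v 0).1 →
      ∃ a : Rank lam, a.1 ⊆ (v 1).1 ∧ pair a.1 x.1 ∈ (v 2).1 :=
    .all (.imp (.mem _ _) (.ex (.and (.subset _ _) (.pair_mem _ _ _))))
  have hD : Expressible fun v : Fin 3 → Rank lam => ∃ x : Rank lam, x.1 ∈ (v 0).1 ∧
      pair (v 1).1 x.1 ∈ (v 2).1 :=
    .ex (.and (.mem _ _) (.pair_mem _ _ _))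
  set k := ord (crit (graph e)) (crit_lt he) with hk
  have hkm : k.1 ∈ (e k).1 := by
    rw [hk, map_ord]
    exact Ordinal.toZFSet_mem_toZFSet_iff.2 (crit_lt_ordMap he)
  have hcr : c.1.rank < crit (graph e) := by
    have := rank_lt_of_mem hc
    rwa [hk, ord, Ordinal.rank_toZFSet] at this
  have hec : e c = c := map_of_rank_lt_crit he hcr
  obtain ⟨a, hac, haf⟩ : ∃ a : Rank lam, a.1 ⊆ (e c).1 ∧ pair a.1 k.1 ∈ (e f).1 :=
    (hS.map_iff e ![k, c, f]).2 hsurj k hkm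
  rw [hec] at hac
  have hea : e a = a := map_of_rank_lt_crit he ((rank_mono hac).trans_lt hcr)
  obtain ⟨x, hxk, hx⟩ : ∃ x : Rank lam, x.1 ∈ k.1 ∧ pair a.1 x.1 ∈ f.1 := by
    refine (hD.map_iff e ![k, a, f]).1 ⟨k, hkm, ?_⟩
    show pair (e a).1 k.1 ∈ (e f).1
    rwa [hea]
  have hex : e x = x := by
    refine map_of_rank_lt_crit he ?_
    have := rank_lt_of_mem hxk
    rwa [hk, ord, Ordinal.rank_toZFSet] at this
  have hx' := (pair_map_mem_iff e a x f).2 hx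
  rw [hea, hex] at hx'
  have hxk' : x = k := (hF.map_iff e ![f]).2 hf a x k hx' haf
  rw [hxk'] at hxk
  exact mem_irrefl _ hxk

theorem noSurjection_critSeq (he : ∃ x, e x ≠ x) (n : ℕ) :
    NoSurjection (ord (critSeq e n) (critSeq_lt he n)) := by
  induction n with
  | zero => exact noSurjection_crit he
  | succ n ih =>
    have := (expressible_noSurjection.map_iff e ![ord (critSeq e n) (critSeq_lt he n)]).2 ih
    have : NoSurjection (e (ord (critSeq e n) (critSeq_lt he n))) := this
    rw [map_ord_eq] at this
    convert this using 2
    exact critSeq_succ n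

/-- An injection of `a` into the power set of `b`, read backwards, is a partial surjection of rank
barely above `a`, so it belongs to `V_lam`. -/
theorem NoSurjection.mk_set_lt (hlam : Order.IsSuccLimit lam) {a b : Ordinal.{u}} (ha : a < lam)
    (h : NoSurjection (ord a ha)) (hb : b < a) : #(Set (Set.Iio b)) < #(Set.Iio a) := by
  by_contra! hle
  obtain ⟨i⟩ := hle
  let A : Set.Iio a → ZFSet.{u} := fun x =>
    ZFSet.range fun y : {y : Set.Iio b // y ∈ i x} => y.1.1.toZFSet
  have hA : ∀ x (y : Set.Iio b), y.1.toZFSet ∈ A x ↔ y ∈ i x := by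
    intro x y
    simp only [A, mem_range, Subtype.exists]
    constructor
    · rintro ⟨z, hz, hzi, hzy⟩
      obtain rfl := Ordinal.toZFSet_injective hzy
      exact hzi
    · exact fun hy => ⟨y.1, y.2, hy, rfl⟩
  have hAinj : Function.Injective A := fun x x' hxx' => i.injective <| by
    ext y
    rw [← hA, ← hA, hxx']
  have hAb : ∀ x, A x ⊆ b.toZFSet := by
    intro x z hz
    obtain ⟨y, rfl⟩ := mem_range.1 hz
    exact Ordinal.toZFSet_mem_toZFSet_iff.2 y.1.2
  have hf : (ZFSet.range fun x : Set.Iio a => pair (A x) x.1.toZFSet) ∈ V_ lam := by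
    refine mem_vonNeumann_of_subset (y := V_ (Order.succ (Order.succ a))) ?_
      (vonNeumann_mem_of_lt (hlam.succ_lt (hlam.succ_lt ha)))
    intro z hz
    obtain ⟨x, rfl⟩ := mem_range.1 hz
    refine pair_mem_vonNeumann_succ ?_ ?_ <;> rw [mem_vonNeumann]
    · exact (rank_mono (hAb x)).trans_lt (by rwa [Ordinal.rank_toZFSet])
    · rw [Ordinal.rank_toZFSet]; exact x.2
  refine h (ord b (hb.trans ha)) ⟨_, hf⟩ (Ordinal.toZFSet_mem_toZFSet_iff.2 hb) ?_ ?_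
  · intro c x y hx hy
    obtain ⟨x', hx'⟩ := mem_range.1 hx
    obtain ⟨y', hy'⟩ := mem_range.1 hy
    obtain ⟨hxc, hxx⟩ := pair_inj.1 hx'
    obtain ⟨hyc, hyy⟩ := pair_inj.1 hy'
    obtain rfl := hAinj (hxc.trans hyc.symm)
    exact Subtype.ext (hxx.symm.trans hyy)
  · intro x hx
    obtain ⟨x', hx', hxx⟩ := Ordinal.mem_toZFSet_iff.1 hx
    refine ⟨⟨A ⟨x', hx'⟩, mem_vonNeumann_of_subset (hAb _) (ord b (hb.trans ha)).2⟩, hAb _, ?_⟩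
    exact mem_range.2 ⟨⟨x', hx'⟩, by rw [← hxx]⟩

end critical

end RankToRank

namespace RankToRank

open FirstOrder ZFSet Cardinal

variable {lam : Ordinal.{u}} {α : Type}

/-! ### Kunen's theorem -/

/-- `g` is an injective function that maps `l` to `l`. -/
def IsInjectionOn (g l : Rank lam) : Prop :=
  (∀ x : Rank lam, x.1 ∈ l.1 → ∃ y : Rank lam, y.1 ∈ l.1 ∧ pair x.1 y.1 ∈ g.1) ∧
  (∀ x y y' : Rank lam, pair x.1 y.1 ∈ g.1 → pair x.1 y'.1 ∈ g.1 → y = y') ∧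
  ∀ x x' y : Rank lam, pair x.1 y.1 ∈ g.1 → pair x'.1 y.1 ∈ g.1 → x = x'

/-- `t` is a function from `w` to `l`. -/
def IsFunction (t w l : Rank lam) : Prop :=
  (∀ z : Rank lam, z.1 ∈ t.1 → ∃ n y : Rank lam, n.1 ∈ w.1 ∧ y.1 ∈ l.1 ∧ z.1 = pair n.1 y.1) ∧
  (∀ n : Rank lam, n.1 ∈ w.1 → ∃ y : Rank lam, pair n.1 y.1 ∈ t.1) ∧
  ∀ n y y' : Rank lam, pair n.1 y.1 ∈ t.1 → pair n.1 y'.1 ∈ t.1 → y = y'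

/-- `s` is the composition of the relations `t` and `g`. -/
def IsComposition (s g t : Rank lam) : Prop :=
  (∀ z : Rank lam, z.1 ∈ s.1 → ∃ n x y : Rank lam, z.1 = pair n.1 y.1 ∧ pair n.1 x.1 ∈ t.1 ∧
    pair x.1 y.1 ∈ g.1) ∧
  ∀ n x y : Rank lam, pair n.1 x.1 ∈ t.1 → pair x.1 y.1 ∈ g.1 → pair n.1 y.1 ∈ s.1

namespace Expressible

theorem isInjectionOn (i j : α) :
    Expressible fun v : α → Rank lam => IsInjectionOn (v i) (v j) :=
  and (all (imp (mem _ _) (ex (and (mem _ _) (pair_mem _ _ _)))))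
    (and (all (all (all (imp (pair_mem _ _ _) (imp (pair_mem _ _ _) (eq _ _))))))
      (all (all (all (imp (pair_mem _ _ _) (imp (pair_mem _ _ _) (eq _ _)))))))

theorem isFunction (i j k : α) :
    Expressible fun v : α → Rank lam => IsFunction (v i) (v j) (v k) :=
  and (all (imp (mem _ _) (ex (ex (and (mem _ _) (and (mem _ _) (eq_pair _ _ _)))))))
    (and (all (imp (mem _ _) (ex (pair_mem _ _ _))))
      (all (all (all (imp (pair_mem _ _ _) (imp (pair_mem _ _ _) (eq _ _)))))))

theorem isComposition (i j k : α) :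
    Expressible fun v : α → Rank lam => IsComposition (v i) (v j) (v k) :=
  and (all (imp (mem _ _) (ex (ex (ex (and (eq_pair _ _ _)
      (and (pair_mem _ _ _) (pair_mem _ _ _))))))))
    (all (all (all (imp (pair_mem _ _ _) (imp (pair_mem _ _ _) (pair_mem _ _ _))))))

end Expressible

/-- Every ordinal below `l` is a value of `f` at a sequence from the range of any given
injection of `l`. -/
def IsJonsson (f w l : Rank lam) : Prop :=
  ∀ g c : Rank lam, IsInjectionOn g l → c.1 ∈ l.1 →
    ∃ t s : Rank lam, IsFunction t w l ∧ IsComposition s g t ∧ pair s.1 c.1 ∈ f.1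

theorem Expressible.isJonsson (i j k : α) :
    Expressible fun v : α → Rank lam => IsJonsson (v i) (v j) (v k) :=
  .all (.all (.imp (.isInjectionOn _ _) (.imp (.mem _ _) (.ex (.ex
    (.and (.isFunction _ _ _) (.and (.isComposition _ _ _) (.pair_mem _ _ _))))))))

theorem IsFunction.exists_eq_seqSet {a : Ordinal.{u}} (hω : Ordinal.omega0 < lam) (ha : a < lam)
    {t : Rank lam} (ht : IsFunction t (ord Ordinal.omega0 hω) (ord a ha)) :
    ∃ s : ℕ → Set.Iio a, t.1 = seqSet fun n => (s n).1.toZFSet := by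
  obtain ⟨h1, h2, h3⟩ := ht
  have hn : ∀ n : ℕ, (n : Ordinal.{u}) < lam := fun n => (Ordinal.natCast_lt_omega0 n).trans hω
  have key : ∀ n : ℕ, ∃ b : Set.Iio a, pair (n : Ordinal.{u}).toZFSet b.1.toZFSet ∈ t.1 := by
    intro n
    obtain ⟨y, hy⟩ := h2 (ord n (hn n))
      (Ordinal.toZFSet_mem_toZFSet_iff.2 (Ordinal.natCast_lt_omega0 n))
    obtain ⟨m, y', -, hy', hp⟩ := h1 ⟨_, mem_rank_of_mem hy⟩ hy
    obtain ⟨-, hyy⟩ := pair_inj.1 hp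
    obtain ⟨b, hb, hby⟩ := Ordinal.mem_toZFSet_iff.1 hy'
    refine ⟨⟨b, hb⟩, ?_⟩
    rw [hby, ← hyy]
    exact hy
  choose s hs using key
  refine ⟨s, ZFSet.ext fun z => ⟨fun hz => ?_, fun hz => ?_⟩⟩
  · obtain ⟨m, y, hm, -, hp⟩ := h1 ⟨z, mem_rank_of_mem hz⟩ hz
    have hp : z = pair m.1 y.1 := hp
    obtain ⟨b, hb, hbm⟩ := Ordinal.mem_toZFSet_iff.1 hm
    obtain ⟨n, rfl⟩ := Ordinal.lt_omega0.1 hb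
    subst hp
    rw [← hbm, natCast_pair_mem_seqSet]
    refine congrArg Subtype.val (h3 m y (ord (s n).1 ((s n).2.trans ha)) hz ?_)
    rw [← hbm]
    exact hs n
  · obtain ⟨n, rfl⟩ := mem_range.1 hz
    exact hs n

theorem isFunction_seqSet {a : Ordinal.{u}} (hω : Ordinal.omega0 < lam) (ha : a < lam)
    (s : ℕ → Set.Iio a) (hs : seqSet (fun n => (s n).1.toZFSet) ∈ V_ lam) :
    IsFunction ⟨_, hs⟩ (ord Ordinal.omega0 hω) (ord a ha) := by
  have hn : ∀ n : ℕ, (n : Ordinal.{u}) < lam := fun n => (Ordinal.natCast_lt_omega0 n).trans hω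
  refine ⟨?_, ?_, ?_⟩
  · intro z hz
    obtain ⟨n, h⟩ := mem_range.1 hz
    exact ⟨ord n (hn n), ord (s n).1 ((s n).2.trans ha),
      Ordinal.toZFSet_mem_toZFSet_iff.2 (Ordinal.natCast_lt_omega0 n),
      Ordinal.toZFSet_mem_toZFSet_iff.2 (s n).2, h.symm⟩
  · intro n h
    obtain ⟨b, hb, hbm⟩ := Ordinal.mem_toZFSet_iff.1 h
    obtain ⟨n, rfl⟩ := Ordinal.lt_omega0.1 hb
    refine ⟨ord (s n).1 ((s n).2.trans ha), ?_⟩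
    rw [← hbm]
    exact natCast_pair_mem_seqSet.2 rfl
  · intro n y y' hy hy'
    obtain ⟨m, hm, hy⟩ := pair_mem_seqSet.1 hy
    obtain ⟨k, hk, hy'⟩ := pair_mem_seqSet.1 hy'
    obtain rfl : m = k := natCast_toZFSet_injective (hm.symm.trans hk)
    exact Subtype.ext (hy.trans hy'.symm)

/-- The set coding a function on the sequences of ordinals below `a`. -/
noncomputable def seqFunSet {a : Ordinal.{u}} (F : (ℕ → Set.Iio a) → Set.Iio a) : ZFSet.{u} :=
  ZFSet.range fun s : ℕ → Set.Iio a => pair (seqSet fun n => (s n).1.toZFSet) (F s).1.toZFSet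

theorem seqSet_toZFSet_injective {a : Ordinal.{u}} :
    Function.Injective fun s : ℕ → Set.Iio a => seqSet fun n => (s n).1.toZFSet := by
  intro s s' h
  funext n
  have h1 : pair (n : Ordinal.{u}).toZFSet (s n).1.toZFSet ∈
      seqSet fun n => (s n).1.toZFSet := natCast_pair_mem_seqSet.2 rfl
  have h : seqSet (fun n => (s n).1.toZFSet) = seqSet fun n => (s' n).1.toZFSet := h
  rw [h, natCast_pair_mem_seqSet] at h1
  exact Subtype.ext (Ordinal.toZFSet_injective h1)

theorem pair_seqSet_mem_seqFunSet {a : Ordinal.{u}} {F : (ℕ → Set.Iio a) → Set.Iio a}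
    {s : ℕ → Set.Iio a} {y : ZFSet.{u}} :
    pair (seqSet fun n => (s n).1.toZFSet) y ∈ seqFunSet F ↔ y = (F s).1.toZFSet := by
  simp only [seqFunSet, mem_range, pair_inj]
  constructor
  · rintro ⟨s', h, rfl⟩
    rw [seqSet_toZFSet_injective h]
  · exact fun h => ⟨s, rfl, h.symm⟩

section bounded

variable {a : Ordinal.{u}}

theorem toZFSet_mem_vonNeumann (x : Set.Iio a) : x.1.toZFSet ∈ V_ a := by
  rw [mem_vonNeumann, Ordinal.rank_toZFSet]
  exact x.2

theorem seqSet_toZFSet_mem (hlam : Order.IsSuccLimit lam) (hωa : Ordinal.omega0 ≤ a)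
    (ha : a < lam) (s : ℕ → Set.Iio a) : seqSet (fun n => (s n).1.toZFSet) ∈ V_ lam :=
  seqSet_mem hlam hωa ha fun n => toZFSet_mem_vonNeumann (s n)

theorem seqFunSet_mem (hlam : Order.IsSuccLimit lam) (hωa : Ordinal.omega0 ≤ a) (ha : a < lam)
    (F : (ℕ → Set.Iio a) → Set.Iio a) : seqFunSet F ∈ V_ lam := by
  set b := Order.succ (Order.succ (Order.succ a))
  have hb : b < lam := hlam.succ_lt (hlam.succ_lt (hlam.succ_lt ha))
  refine mem_vonNeumann_of_subset (y := V_ (Order.succ (Order.succ b))) ?_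
    (vonNeumann_mem_of_lt (hlam.succ_lt (hlam.succ_lt hb)))
  intro z hz
  obtain ⟨s, rfl⟩ := mem_range.1 hz
  refine pair_mem_vonNeumann_succ ?_ ?_
  · rw [mem_vonNeumann]
    exact Order.lt_succ_of_le (subset_vonNeumann.1
      (seqSet_subset hωa fun n => toZFSet_mem_vonNeumann (s n)))
  · refine vonNeumann_subset_of_le ?_ (toZFSet_mem_vonNeumann (F s))
    exact ((Order.le_succ _).trans (Order.le_succ _)).trans (Order.le_succ _)

theorem isJonsson_seqFunSet (hlam : Order.IsSuccLimit lam) (hωa : Ordinal.omega0 ≤ a)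
    (ha : a < lam) {F : (ℕ → Set.Iio a) → Set.Iio a}
    (hF : ∀ g : Set.Iio a → Set.Iio a, Function.Injective g → ∀ y, ∃ t, F (g ∘ t) = y) :
    IsJonsson ⟨_, seqFunSet_mem hlam hωa ha F⟩ (ord Ordinal.omega0 (hωa.trans_lt ha))
      (ord a ha) := by
  intro g c ⟨hg, hgfun, hginj⟩ hc
  have key : ∀ x : Set.Iio a, ∃ y : Set.Iio a, pair x.1.toZFSet y.1.toZFSet ∈ g.1 := by
    intro x
    obtain ⟨y, hy, hxy⟩ := hg (ord x.1 (x.2.trans ha)) (Ordinal.toZFSet_mem_toZFSet_iff.2 x.2)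
    obtain ⟨b, hb, hby⟩ := Ordinal.mem_toZFSet_iff.1 hy
    refine ⟨⟨b, hb⟩, ?_⟩
    rw [hby]
    exact hxy
  choose G hG using key
  have hGinj : Function.Injective G := by
    intro x x' h
    have h1 := hG x
    rw [h] at h1
    have := hginj (ord x.1 (x.2.trans ha)) (ord x'.1 (x'.2.trans ha))
      (ord (G x').1 ((G x').2.trans ha)) h1 (hG x')
    exact Subtype.ext (Ordinal.toZFSet_injective (congrArg Subtype.val this))
  obtain ⟨b, hb, hbc⟩ := Ordinal.mem_toZFSet_iff.1 hc
  obtain ⟨t, ht⟩ := hF G hGinj ⟨b, hb⟩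
  refine ⟨⟨_, seqSet_toZFSet_mem hlam hωa ha t⟩, ⟨_, seqSet_toZFSet_mem hlam hωa ha (G ∘ t)⟩,
    isFunction_seqSet _ _ _ _, ⟨?_, ?_⟩, ?_⟩
  · intro z hz
    obtain ⟨n, h⟩ := mem_range.1 hz
    exact ⟨ord n ((Ordinal.natCast_lt_omega0 n).trans (hωa.trans_lt ha)),
      ord (t n).1 ((t n).2.trans ha), ord (G (t n)).1 ((G (t n)).2.trans ha), h.symm,
      natCast_pair_mem_seqSet.2 rfl, hG (t n)⟩
  · intro n x y hx hy
    obtain ⟨m, hm, hxm⟩ := pair_mem_seqSet.1 hx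
    refine pair_mem_seqSet.2 ⟨m, hm, ?_⟩
    rw [hxm] at hy
    exact congrArg Subtype.val (hgfun (ord (t m).1 ((t m).2.trans ha)) y
      (ord (G (t m)).1 ((G (t m)).2.trans ha)) hy (hG (t m)))
  · refine pair_seqSet_mem_seqFunSet.2 ?_
    rw [ht, hbc]

end bounded

section kunen

variable {e : Rank lam ↪ₑ[setLang] Rank lam}

theorem map_seqSet_toZFSet (hlam : Order.IsSuccLimit lam) (he : ∃ x, e x ≠ x) {a : Ordinal.{u}}
    (ha : a < lam) (s : ℕ → Set.Iio a) (hs : seqSet (fun n => (s n).1.toZFSet) ∈ V_ lam) :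
    (e ⟨_, hs⟩).1 = seqSet fun n => (ordMap e (s n).1).toZFSet :=
  (map_seqSet hlam he (fun n => ord (s n).1 ((s n).2.trans ha)) hs).trans
    (congrArg seqSet (funext fun _ => map_ord e _))

theorem lt_iSup_critSeq_iff {a : Ordinal.{u}} : a < ⨆ n, critSeq e n ↔ ∃ n, a < critSeq e n :=
  Ordinal.lt_iSup_iff

theorem critSeq_lt_iSup (he : ∃ x, e x ≠ x) (n : ℕ) : critSeq e n < ⨆ n, critSeq e n :=
  lt_iSup_critSeq_iff.2 ⟨n + 1, critSeq_lt_succ he n⟩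

/-- The critical sequence is an element of `V_lam` cofinal in `l`, so its image is cofinal in
`e(l)`; that image is the sequence shifted by one, which stays below `l`. -/
theorem ordMap_iSup_critSeq (hlam : Order.IsSuccLimit lam) (he : ∃ x, e x ≠ x)
    (hl : ⨆ n, critSeq e n < lam) : ordMap e (⨆ n, critSeq e n) = ⨆ n, critSeq e n := by
  set l := ⨆ n, critSeq e n with hldef
  have hωl : Ordinal.omega0 ≤ l := ((omega0_lt_crit hlam he).trans (critSeq_lt_iSup he 0)).le
  let c : ℕ → Set.Iio l := fun n => ⟨critSeq e n, critSeq_lt_iSup he n⟩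
  have hs := seqSet_toZFSet_mem hlam hωl hl c
  have hE : Expressible fun v : Fin 2 → Rank lam => ∀ x : Rank lam, x.1 ∈ (v 0).1 →
      ∃ n y : Rank lam, pair n.1 y.1 ∈ (v 1).1 ∧ x.1 ∈ y.1 :=
    .all (.imp (.mem _ _) (.ex (.ex (.and (.pair_mem _ _ _) (.mem _ _)))))
  have h : ∀ x : Rank lam, x.1 ∈ (e (ord l hl)).1 →
      ∃ n y : Rank lam, pair n.1 y.1 ∈ (e ⟨_, hs⟩).1 ∧ x.1 ∈ y.1 := by
    refine (hE.map_iff e ![ord l hl, ⟨_, hs⟩]).2 ?_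
    intro x hx
    obtain ⟨b, hb, hbx⟩ := Ordinal.mem_toZFSet_iff.1 hx
    obtain ⟨n, hn⟩ := lt_iSup_critSeq_iff.1 hb
    refine ⟨ord n ((natCast_lt_crit hlam he n).trans (crit_lt he)),
      ord (critSeq e n) (critSeq_lt he n), natCast_pair_mem_seqSet.2 rfl, ?_⟩
    rw [← hbx]
    exact Ordinal.toZFSet_mem_toZFSet_iff.2 hn
  refine le_antisymm ?_ (le_ordMap e hl)
  by_contra! hlt
  obtain ⟨n, y, hy, hly⟩ := h (ord l hl) (by
    rw [map_ord]
    exact Ordinal.toZFSet_mem_toZFSet_iff.2 hlt)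
  rw [map_seqSet_toZFSet hlam he hl, pair_mem_seqSet] at hy
  obtain ⟨m, -, hy⟩ := hy
  rw [hy, ← critSeq_succ] at hly
  exact (Ordinal.toZFSet_mem_toZFSet_iff.1 hly).not_gt (critSeq_lt_iSup he _)

theorem mk_set_le_mk_seq_critSeq (hlam : Order.IsSuccLimit lam) (he : ∃ x, e x ≠ x) :
    #(Set (Set.Iio (⨆ n, critSeq e n))) ≤ #(ℕ → Set.Iio (⨆ n, critSeq e n)) := by
  refine mk_set_le_mk_seq (fun n => {x | x.1 < critSeq e n})
    (fun x => lt_iSup_critSeq_iff.1 x.2) fun n => ?_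
  have h1 := (noSurjection_critSeq he (n + 1)).mk_set_lt hlam _ (critSeq_lt_succ he n)
  have h2 : #(Set.Iio (critSeq e (n + 1))) ≤ #(Set.Iio (⨆ n, critSeq e n)) :=
    Cardinal.mk_le_mk_of_subset (Set.Iio_subset_Iio (critSeq_lt_iSup he _).le)
  refine le_trans ?_ (h1.le.trans h2)
  rw [Cardinal.mk_set, Cardinal.mk_set]
  refine Cardinal.power_le_power_left two_ne_zero ?_
  exact ⟨⟨fun x => ⟨x.1.1, x.2⟩, fun x y h =>
    Subtype.ext (Subtype.ext (congrArg (fun z : Set.Iio (critSeq e n) => z.1) h))⟩⟩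

/-- The critical sequence of a nontrivial elementary embedding of `V_lam` is cofinal in `lam`. -/
theorem not_iSup_critSeq_lt (hlam : Order.IsSuccLimit lam) (he : ∃ x, e x ≠ x) :
    ¬ ⨆ n, critSeq e n < lam := by
  intro hl
  have hfix := ordMap_iSup_critSeq hlam he hl
  have hκ : crit (graph e) < ⨆ n, critSeq e n := critSeq_lt_iSup he 0
  have hmk := mk_set_le_mk_seq_critSeq hlam he
  set l := ⨆ n, critSeq e n with hldef
  have hωl : Ordinal.omega0 ≤ l := ((omega0_lt_crit hlam he).trans hκ).le
  have hω : Ordinal.omega0 < lam := hωl.trans_lt hl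
  have : Infinite (Set.Iio l) := Infinite.of_injective
    (fun n : ℕ => (⟨n, (Ordinal.natCast_lt_omega0 n).trans_le hωl⟩ : Set.Iio l))
    fun m n h => Nat.cast_injective (congrArg Subtype.val h)
  obtain ⟨F, hF⟩ := exists_jonsson_function hmk
  set f : Rank lam := ⟨_, seqFunSet_mem hlam hωl hl F⟩ with hf
  have heω : e (ord Ordinal.omega0 hω) = ord Ordinal.omega0 hω :=
    map_ord_of_lt_crit he (omega0_lt_crit hlam he) hω
  have hel : e (ord l hl) = ord l hl := Subtype.ext (by rw [map_ord, hfix]; rfl)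
  have hJ : IsJonsson (e f) (ord Ordinal.omega0 hω) (ord l hl) := by
    have : IsJonsson (e f) (e (ord Ordinal.omega0 hω)) (e (ord l hl)) :=
      ((Expressible.isJonsson 0 1 2).map_iff e ![f, ord Ordinal.omega0 hω, ord l hl]).2
        (isJonsson_seqFunSet hlam hωl hl hF)
    rwa [heω, hel] at this
  have hfun : ∀ s y y' : Rank lam, pair s.1 y.1 ∈ (e f).1 → pair s.1 y'.1 ∈ (e f).1 → y = y' := by
    have hE : Expressible fun v : Fin 1 → Rank lam => ∀ n y z : Rank lam,
        pair n.1 y.1 ∈ (v 0).1 → pair n.1 z.1 ∈ (v 0).1 → y = z :=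
      .all (.all (.all (.imp (.pair_mem _ _ _) (.imp (.pair_mem _ _ _) (.eq _ _)))))
    refine (hE.map_iff e ![f]).2 ?_
    intro s y y' hy hy'
    obtain ⟨t, ht⟩ := mem_range.1 hy
    obtain ⟨hts, hty⟩ := pair_inj.1 ht
    have hy' : pair s.1 y'.1 ∈ seqFunSet F := hy'
    rw [← hts, pair_seqSet_mem_seqFunSet] at hy'
    exact Subtype.ext (hty.symm.trans hy'.symm)
  -- the restriction of `e` to `l`
  have hlt : ∀ x : Set.Iio l, ordMap e x.1 < l := fun x => by
    conv_rhs => rw [← hfix]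
    exact (ordMap_lt_ordMap e (x.2.trans hl) hl).2 x.2
  have hg : (ZFSet.range fun x : Set.Iio l => pair x.1.toZFSet (ordMap e x.1).toZFSet) ∈
      V_ lam := by
    refine mem_vonNeumann_of_subset (y := V_ (Order.succ (Order.succ l))) ?_
      (vonNeumann_mem_of_lt (hlam.succ_lt (hlam.succ_lt hl)))
    intro z hz
    obtain ⟨x, rfl⟩ := mem_range.1 hz
    exact pair_mem_vonNeumann_succ (toZFSet_mem_vonNeumann x)
      (toZFSet_mem_vonNeumann ⟨_, hlt x⟩)
  have hpair : ∀ x y : ZFSet.{u}, pair x y ∈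
      (ZFSet.range fun x : Set.Iio l => pair x.1.toZFSet (ordMap e x.1).toZFSet) ↔
      ∃ b : Set.Iio l, x = b.1.toZFSet ∧ y = (ordMap e b.1).toZFSet := by
    intro x y
    rw [mem_range]
    exact exists_congr fun b => by rw [pair_inj, eq_comm, @eq_comm _ y]
  have hginj : IsInjectionOn ⟨_, hg⟩ (ord l hl) := by
    refine ⟨?_, ?_, ?_⟩
    · intro x hx
      obtain ⟨b, hb, hbx⟩ := Ordinal.mem_toZFSet_iff.1 hx
      exact ⟨ord (ordMap e b) (ordMap_lt e (hb.trans hl)),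
        Ordinal.toZFSet_mem_toZFSet_iff.2 (hlt ⟨b, hb⟩), (hpair _ _).2 ⟨⟨b, hb⟩, hbx.symm, rfl⟩⟩
    · intro x y y' hy hy'
      obtain ⟨b, hb, h⟩ := (hpair _ _).1 hy
      obtain ⟨b', hb', h'⟩ := (hpair _ _).1 hy'
      have := Ordinal.toZFSet_injective (hb.symm.trans hb')
      exact Subtype.ext (by rw [h, h', this])
    · intro x x' y hy hy'
      obtain ⟨b, hb, h⟩ := (hpair _ _).1 hy
      obtain ⟨b', hb', h'⟩ := (hpair _ _).1 hy'
      have heq := Ordinal.toZFSet_injective (h.symm.trans h')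
      have : b.1 = b'.1 := le_antisymm
        ((ordMap_le_ordMap e (b.2.trans hl) (b'.2.trans hl)).1 heq.le)
        ((ordMap_le_ordMap e (b'.2.trans hl) (b.2.trans hl)).1 heq.ge)
      exact Subtype.ext (by rw [hb, hb', this])
  -- The transferred property is applied to the restriction of `e` to `l`, with the critical point
  -- as the value to be attained.
  obtain ⟨t, s, ht, ⟨hs1, hs2⟩, hsf⟩ := hJ ⟨_, hg⟩ (ord (crit (graph e)) (crit_lt he)) hginj
    (Ordinal.toZFSet_mem_toZFSet_iff.2 hκ)
  obtain ⟨q, hq⟩ := ht.exists_eq_seqSet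
  have hqn : ∀ n, (q n).1 < lam := fun n => (q n).2.trans hl
  have htq : t = ⟨_, seqSet_toZFSet_mem hlam hωl hl q⟩ := Subtype.ext hq
  have het : (e t).1 = seqSet fun n => (ordMap e (q n).1).toZFSet := by
    rw [htq, map_seqSet_toZFSet hlam he hl]
  -- Composing `e` with an `ω`-sequence is the same as applying `e` to it.
  have hst : s = e t := by
    refine Subtype.ext (ZFSet.ext fun z => ?_)
    rw [het]
    constructor
    · intro hz
      obtain ⟨n, x, y, hzy, hnx, hxy⟩ := hs1 ⟨z, mem_rank_of_mem hz⟩ hz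
      have hzy : z = pair n.1 y.1 := hzy
      rw [hq, pair_mem_seqSet] at hnx
      obtain ⟨m, hm, hx⟩ := hnx
      obtain ⟨b, hb, hy⟩ := (hpair _ _).1 hxy
      have hbq := Ordinal.toZFSet_injective (hx.symm.trans hb)
      rw [hzy, pair_mem_seqSet]
      exact ⟨m, hm, by rw [hy, hbq]⟩
    · intro hz
      obtain ⟨n, rfl⟩ := mem_range.1 hz
      refine hs2 (ord n ((Ordinal.natCast_lt_omega0 n).trans hω)) (ord (q n).1 (hqn n))
        (ord (ordMap e (q n).1) (ordMap_lt e (hqn n))) ?_ ((hpair _ _).2 ⟨q n, rfl, rfl⟩)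
      rw [hq]
      exact natCast_pair_mem_seqSet.2 rfl
  have hFq : (F q).1 < lam := (F q).2.trans hl
  have h1 : pair (e t).1 (e (ord (F q).1 hFq)).1 ∈ (e f).1 := by
    rw [pair_map_mem_iff, hq]
    exact pair_seqSet_mem_seqFunSet.2 rfl
  rw [hst] at hsf
  have h2 := congrArg Subtype.val (hfun _ _ _ hsf h1)
  rw [map_ord] at h2
  have h3 : crit (graph e) = ordMap e (F q).1 := Ordinal.toZFSet_injective h2
  -- The critical point is not in the range: smaller ordinals are fixed, the others go strictly
  -- above it.
  rcases lt_or_ge (F q).1 (crit (graph e)) with h | h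
  · rw [ordMap_of_lt_crit he h] at h3
    exact h.ne' h3
  · have := (ordMap_le_ordMap e (crit_lt he) hFq).2 h
    rw [← h3] at this
    exact this.not_gt (crit_lt_ordMap he)

/-- Otherwise `d` is closed under `e`, and the whole critical sequence stays below `d < lam`. -/
theorem exists_le_ordMap (hlam : Order.IsSuccLimit lam) (he : ∃ x, e x ≠ x) {d : Ordinal.{u}}
    (hd : crit (graph e) < d) (hdl : d < lam) : ∃ a < d, d ≤ ordMap e a := by
  by_contra! h
  refine not_iSup_critSeq_lt hlam he (lt_of_le_of_lt (Ordinal.iSup_le fun n => ?_) hdl)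
  have : critSeq e n < d := by
    induction n with
    | zero => exact hd
    | succ n ih => rw [critSeq_succ]; exact h _ ih
  exact this.le

end kunen

end RankToRank

namespace RankToRank

open FirstOrder ZFSet

variable {lam : Ordinal.{u}} {α β : Type}

/-! ### Definability with parameters -/

theorem mem_defIn {A : Set ZFSet.{u}} {R : (β → Rank lam) → Rank lam → Prop}
    (hR : Expressible fun w : β ⊕ Unit → Rank lam => R (fun i => w (.inl i)) (w (.inr ())))
    {w : β → Rank lam} (hw : ∀ i, (w i).1 ∈ A) {b : Rank lam} (hb : ∀ y, R w y ↔ y = b) :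
    b.1 ∈ DefIn lam A := by
  obtain ⟨φ, hφ⟩ := hR
  refine ⟨b.2, Set.definable_iff_exists_formula_sum.2
    ⟨φ.relabel (Sum.map (fun i => ⟨w i, hw i⟩) fun _ => 0), ?_⟩⟩
  ext v
  refine (hb (v 0)).symm.trans (Iff.trans ?_ Language.Formula.realize_relabel.symm)
  have := hφ (Sum.elim Subtype.val v ∘ Sum.map (fun i => (⟨w i, hw i⟩ : {x : Rank lam | x.1 ∈ A}))
    fun _ => 0)
  exact this.symm

/-- A formula mentions finitely many parameters, so they can be listed as a tuple indexed by `Fin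
n`, which can then be coded by a single set. -/
theorem exists_expressible_of_mem_defIn {A : Set ZFSet.{u}} {b : ZFSet.{u}}
    (h : b ∈ DefIn lam A) :
    ∃ (hb : b ∈ V_ lam) (n : ℕ) (R : (Fin n → Rank lam) → Rank lam → Prop)
      (w : Fin n → Rank lam),
      (Expressible fun v : Fin n ⊕ Unit → Rank lam => R (fun i => v (.inl i)) (v (.inr ()))) ∧
      (∀ i, (w i).1 ∈ A) ∧ ∀ y, R w y ↔ y = ⟨b, hb⟩ := by
  obtain ⟨hb, h⟩ := h
  obtain ⟨A₀, hA₀, h⟩ := Set.definable_iff_finitely_definable.1 h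
  obtain ⟨φ, hφ⟩ := Set.definable_iff_exists_formula_sum.1 h
  let eq := A₀.equivFin
  let ψ : setLang.Formula (Fin A₀.card ⊕ Unit) := φ.relabel (Sum.map eq fun _ => ())
  refine ⟨hb, A₀.card, fun v y => ψ.Realize (Sum.elim v fun _ => y), fun i => (eq.symm i).1,
    ⟨ψ, fun v => ?_⟩, fun i => hA₀ (eq.symm i).2, fun y => ?_⟩
  · rw [iff_iff_eq]
    congr 1
    funext i
    rcases i with i | i <;> rfl
  · have := Set.ext_iff.1 hφ fun _ => y
    refine (Language.Formula.realize_relabel.trans ?_).trans this.symm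
    rw [iff_iff_eq]
    show φ.Realize _ = φ.Realize _
    congr 1
    funext i
    rcases i with i | i
    · simp [eq]
    · rfl

/-! ### Codes of tuples -/

/-- A set coding a tuple of sets. -/
def tupleCode : ∀ {n : ℕ}, (Fin n → ZFSet.{u}) → ZFSet.{u}
  | 0, _ => ∅
  | _ + 1, q => pair (q 0) (tupleCode fun i => q i.succ)

theorem tupleCode_injective {n : ℕ} : Function.Injective (tupleCode (n := n)) := by
  induction n with
  | zero => exact fun _ _ _ => Subsingleton.elim _ _
  | succ n ih =>
    intro q q' h
    obtain ⟨h0, h1⟩ := pair_inj.1 h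
    have := ih h1
    funext i
    refine Fin.cases h0 (fun i => congrFun this i) i

theorem tupleCode_mem {o : Ordinal.{u}} (ho : Order.IsSuccLimit o) {n : ℕ}
    {q : Fin n → ZFSet.{u}} (hq : ∀ i, q i ∈ V_ o) : tupleCode q ∈ V_ o := by
  induction n with
  | zero => rw [tupleCode, mem_vonNeumann, rank_empty]; exact ho.bot_lt
  | succ n ih => exact pair_mem_vonNeumann ho (hq 0) (ih fun i => hq i.succ)

/-- Codes of tuples from a level below a limit `o` lie in a fixed level below `o`. -/
theorem exists_tupleCode_mem {o a : Ordinal.{u}} (ho : Order.IsSuccLimit o) (ha : a < o) (n : ℕ) :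
    ∃ b < o, a ≤ b ∧ ∀ q : Fin n → ZFSet.{u}, (∀ i, q i ∈ V_ a) → tupleCode q ∈ V_ b := by
  induction n with
  | zero =>
    refine ⟨Order.succ a, ho.succ_lt ha, Order.le_succ a, fun q _ => ?_⟩
    rw [tupleCode, mem_vonNeumann, rank_empty]
    exact zero_le.trans_lt (Order.lt_succ a)
  | succ n ih =>
    obtain ⟨b, hb, hab, h⟩ := ih
    refine ⟨_, ho.succ_lt (ho.succ_lt hb),
      hab.trans ((Order.le_succ b).trans (Order.le_succ _)), fun q hq => ?_⟩
    exact pair_mem_vonNeumann_succ (vonNeumann_subset_of_le hab (hq 0)) (h _ fun i => hq i.succ)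

theorem Expressible.eq_tupleCode (i : α) {n : ℕ} (σ : Fin n → α) :
    Expressible fun v : α → Rank lam => (v i).1 = tupleCode fun k => (v (σ k)).1 := by
  induction n generalizing α with
  | zero =>
    refine congr (P := fun v => ¬ ∃ x : Rank lam, x.1 ∈ (v i).1) (.not (.ex (.mem _ _))) fun v => ?_
    rw [tupleCode, ZFSet.eq_empty]
    exact ⟨fun h ⟨x, hx⟩ => h _ hx, fun h x hx => h ⟨⟨x, mem_rank_of_mem hx⟩, hx⟩⟩
  | succ n ih =>
    refine congr (P := fun v => ∃ c : Rank lam, c.1 = (tupleCode fun k => (v (σ k.succ)).1) ∧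
      (v i).1 = pair (v (σ 0)).1 c.1) (.ex (.and (ih _ _) (.eq_pair _ _ _))) fun v => ?_
    rw [tupleCode]
    constructor
    · intro h
      have h1 : ({(v (σ 0)).1, tupleCode fun k => (v (σ k.succ)).1} : ZFSet.{u}) ∈ (v i).1 := by
        rw [h]; simp [pair]
      refine ⟨⟨_, mem_rank_of_mem (y := ⟨_, mem_rank_of_mem h1⟩) (mem_pair.2 (.inr rfl))⟩,
        rfl, h⟩
    · rintro ⟨c, hc, h⟩
      rw [h, hc]

end RankToRank

namespace RankToRank

open FirstOrder ZFSet

variable {lam : Ordinal.{u}}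

/-! ### Definability from the range of a product -/

variable {e f g : Rank lam ↪ₑ[setLang] Rank lam}

/-- Each value of the product of `e` and `f` is given by a function in the range of `e`. -/
theorem exists_rng_app (hg : app lam (graph e) (graph f) = graph g) (x : Rank lam) :
    ∃ c : Rank lam, c.1 ∈ rng (graph e) ∧ ∀ y : Rank lam, pair x.1 y.1 ∈ c.1 ↔ y = g x := by
  have hx : pair x.1 (g x).1 ∈ app lam (graph e) (graph f) := by
    rw [hg]; exact pair_mem_graph_iff.2 rfl
  obtain ⟨a, ha, hx⟩ := mem_app_graph.1 hx
  refine ⟨e (graphPart f a ha), mem_rng_graph.2 ⟨_, rfl⟩, fun y => ⟨fun hy => ?_, ?_⟩⟩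
  · have : pair x.1 y.1 ∈ app lam (graph e) (graph f) := mem_app_graph.2 ⟨a, ha, hy⟩
    rw [hg] at this
    exact (pair_mem_graph_iff.1 this).symm
  · rintro rfl
    exact hx

theorem map_mem_defIn (hg : app lam (graph e) (graph f) = graph g) {A : Set ZFSet.{u}}
    (hA : rng (graph e) ⊆ A) {x : Rank lam} (hx : x.1 ∈ A) : (g x).1 ∈ DefIn lam A := by
  obtain ⟨c, hc, h⟩ := exists_rng_app hg x
  refine mem_defIn (R := fun w y => pair (w 1).1 y.1 ∈ (w 0).1) (.pair_mem _ _ _)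
    (w := ![c, x]) ?_ h
  intro i
  fin_cases i
  exacts [hA hc, hx]

theorem mem_defIn_of_pair_mem_map (hg : app lam (graph e) (graph f) = graph g)
    {A : Set ZFSet.{u}} (hA : rng (graph e) ⊆ A) {x p b : Rank lam} (hx : x.1 ∈ A)
    (hp : p.1 ∈ A) (hb : ∀ y : Rank lam, pair p.1 y.1 ∈ (g x).1 ↔ y = b) :
    b.1 ∈ DefIn lam A := by
  obtain ⟨c, hc, h⟩ := exists_rng_app hg x
  refine mem_defIn (R := fun w y => ∃ z : Rank lam, pair (w 1).1 z.1 ∈ (w 0).1 ∧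
    pair (w 2).1 y.1 ∈ z.1) (.ex (.and (.pair_mem _ _ _) (.pair_mem _ _ _)))
    (w := ![c, x, p]) ?_ ?_
  · intro i
    fin_cases i
    exacts [hA hc, hx, hp]
  · intro y
    show (∃ z : Rank lam, pair x.1 z.1 ∈ c.1 ∧ pair p.1 y.1 ∈ z.1) ↔ y = b
    simp only [h, exists_eq_left, hb]

/-- Let `x` be a tuple, `R` expressible, and `a` below the limit `d`. The partial function that
takes a tuple `q` from `V_a` to the ordinal below `a` defined by `R` from `x` and `q` is coded by
an element `s` of `V_d`; applying `g` to it gives the corresponding function for `g x` and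
`g a`. -/
theorem exists_map_definition {n : ℕ}
    {R : (Fin n → Rank lam) → (Fin n → Rank lam) → Rank lam → Prop}
    (hR : Expressible fun w : (Fin n ⊕ Fin n) ⊕ Unit → Rank lam =>
      R (fun i => w (.inl (.inl i))) (fun i => w (.inl (.inr i))) (w (.inr ())))
    (x : Fin n → Rank lam) {a d : Ordinal.{u}} (hd : Order.IsSuccLimit d) (had : a < d)
    (hdl : d ≤ lam) :
    ∃ s : Rank lam, s.1 ∈ V_ d ∧ ∀ (q : Fin n → Rank lam) (c b : Rank lam),
      (∀ i, (q i).1 ∈ V_ (ordMap g a)) → b.1 ∈ (ordMap g a).toZFSet →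
      c.1 = (tupleCode fun i => (q i).1) →
      (∀ z, R (fun i => g (x i)) q z ↔ z = b) → ∀ y : Rank lam, pair c.1 y.1 ∈ (g s).1 ↔ y = b := by
  have hal := had.trans_le hdl
  obtain ⟨b, hbd, hab, hcode⟩ := exists_tupleCode_mem hd had n
  have hb'd : Order.succ (Order.succ b) < d := hd.succ_lt (hd.succ_lt hbd)
  -- The level `b < d` contains all codes of tuples from `V_a` and all ordinals below `a`; two more
  -- levels accommodate the pairs.
  let S : ZFSet.{u} := (V_ (Order.succ (Order.succ b))).sep fun t =>
    ∃ (q : Fin n → Rank lam) (z : Rank lam), (∀ z', R x q z' ↔ z' = z) ∧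
      t = pair (tupleCode fun i => (q i).1) z.1
  have hS : S ∈ V_ d := mem_vonNeumann_of_subset sep_subset (vonNeumann_mem_of_lt hb'd)
  have hSl : S ∈ V_ lam := vonNeumann_subset_of_le hdl hS
  -- The defining property of `S`, written with `S`, `V_a`, `a` and the tuple `x` as the only
  -- parameters, so that `g` can be applied to it.
  have hE : Expressible fun v : Fin 3 ⊕ Fin n → Rank lam => ∀ q : Fin n → Rank lam,
      ∀ c z : Rank lam, (∀ i, (q i).1 ∈ (v (.inl 1)).1) → z.1 ∈ (v (.inl 2)).1 →
      c.1 = (tupleCode fun i => (q i).1) →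
      (∀ z', R (fun i => v (.inr i)) q z' ↔ z' = z) →
      ∀ y : Rank lam, pair c.1 y.1 ∈ (v (.inl 0)).1 ↔ y = z := by
    refine .forall_tuple (.all (.all (.imp (.forall_fin fun i => .mem _ _) (.imp (.mem _ _)
      (.imp (.eq_tupleCode _ _) (.imp (.all (.iff ?_ (.eq _ _)))
        (.all (.iff (.pair_mem _ _ _) (.eq _ _)))))))))
    exact hR.comp (β := ((((Fin 3 ⊕ Fin n) ⊕ Fin n) ⊕ Unit) ⊕ Unit) ⊕ Unit)
      (Sum.elim (Sum.elim (fun i => .inl (.inl (.inl (.inl (.inr i)))))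
      fun i => .inl (.inl (.inl (.inr i)))) fun _ => .inr ())
  have key := (hE.map_iff g (Sum.elim ![⟨S, hSl⟩, level a hal, ord a hal] x)).2 ?_
  · refine ⟨⟨S, hSl⟩, hS, fun q c b hq hb hc hRb => key q c b ?_ ?_ hc hRb⟩
    · intro i
      show (q i).1 ∈ (g (level a hal)).1
      rw [map_level]
      exact hq i
    · show b.1 ∈ (g (ord a hal)).1
      rw [map_ord]
      exact hb
  · intro q c z hq hz hc hRz y
    show pair c.1 y.1 ∈ S ↔ y = z
    rw [mem_sep]
    constructor
    · rintro ⟨-, q', z', hz', h⟩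
      obtain ⟨h1, h2⟩ := pair_inj.1 h
      have hqq : q = q' := funext fun i =>
        Subtype.ext (congrFun (tupleCode_injective (hc.symm.trans h1)) i)
      subst hqq
      have hyz' : y = z' := Subtype.ext h2
      rw [hyz']
      exact (hRz z').1 ((hz' z').2 rfl)
    · rintro rfl
      refine ⟨pair_mem_vonNeumann_succ ?_ ?_, q, y, hRz, by rw [hc]⟩
      · rw [hc]
        exact hcode _ hq
      · refine vonNeumann_subset_of_le hab ?_
        obtain ⟨o, ho, hoy⟩ := Ordinal.mem_toZFSet_iff.1 hz
        rw [← hoy]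
        exact toZFSet_mem_vonNeumann ⟨o, ho⟩

/-- The inductive step: parameters `g x` are absorbed into `g s`, where `s` itself lies in `V_d`, so
the definition uses only `rng e` and `V_d`. -/
theorem defIn_app_inter_interval (hlam : Order.IsSuccLimit lam)
    (hg : app lam (graph e) (graph f) = graph g) (hne : ∃ x, g x ≠ x)
    {d m : Ordinal.{u}} (hd : Order.IsSuccLimit d) (hdl : d < lam)
    (hcrit : crit (graph g) < d)
    (hdef : DefIn lam (rng (graph e) ∪ {x | x ∈ V_ d}) ∩ interval d m = ∅) :
    DefIn lam (rng (graph g) ∪ {x | x ∈ V_ d}) ∩ interval d m = ∅ := by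
  set A := rng (graph e) ∪ {x | x ∈ V_ d} with hA
  have hAe : rng (graph e) ⊆ A := Set.subset_union_left
  have hAd : ∀ x ∈ V_ d, x ∈ A := fun x hx => Or.inr hx
  obtain ⟨a, had, hda⟩ := exists_le_ordMap hlam hne hcrit hdl
  have hal := had.trans hdl
  -- The value of `g` at `a` is definable from `rng e ∪ V_d` and is at least `d`, so it cannot be
  -- below `m`.
  have hma : m ≤ ordMap g a := by
    by_contra! h
    have h1 : (g (ord a hal)).1 ∈ DefIn lam A :=
      map_mem_defIn hg hAe (hAd _ (toZFSet_mem_vonNeumann ⟨a, had⟩))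
    rw [map_ord] at h1
    exact (Set.eq_empty_iff_forall_notMem.1 hdef) _ ⟨h1, _, ⟨hda, h⟩, rfl⟩
  refine Set.eq_empty_iff_forall_notMem.2 ?_
  rintro y ⟨hy, o, ⟨hdo, hom⟩, rfl⟩
  obtain ⟨hb, n, R, w, hR, hw, hRw⟩ := exists_expressible_of_mem_defIn hy
  have hz : (0 : Ordinal.{u}) < d := hd.bot_lt
  -- separate the parameters in the range of `g` from those in `V_d`
  have hsplit : ∀ i, ∃ (x p : Rank lam) (t : Bool), p.1 ∈ V_ d ∧ w i = bif t then g x else p := by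
    intro i
    rcases hw i with h | h
    · obtain ⟨x, hx⟩ := mem_rng_graph.1 h
      -- The coordinate not selected by `t i` is filler; it must only keep `p` inside `V_d`.
      exact ⟨x, ord 0 (hz.trans hdl), true, toZFSet_mem_vonNeumann ⟨0, hz⟩, Subtype.ext hx.symm⟩
    · exact ⟨w i, w i, false, h, rfl⟩
  choose x p t hp hwt using hsplit
  let R' : (Fin n → Rank lam) → (Fin n → Rank lam) → Rank lam → Prop := fun x p y =>
    R (fun i => bif t i then x i else p i) y
  have hR' : Expressible fun w : (Fin n ⊕ Fin n) ⊕ Unit → Rank lam =>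
      R' (fun i => w (.inl (.inl i))) (fun i => w (.inl (.inr i))) (w (.inr ())) := by
    refine (hR.comp (Sum.elim (fun i => .inl (bif t i then .inl i else .inr i))
      fun _ => .inr ())).congr fun v => ?_
    rw [iff_iff_eq]
    show R _ _ = R _ _
    congr 1
    funext i
    cases h : t i <;> simp [h]
  obtain ⟨s, hs, H⟩ := exists_map_definition (g := g) hR' x hd had hdl.le
  have hc : (tupleCode fun i => (p i).1) ∈ V_ d := tupleCode_mem hd hp
  have hyd : o.toZFSet ∈ DefIn lam A := by
    refine mem_defIn_of_pair_mem_map hg hAe (x := s)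
      (p := ⟨_, vonNeumann_subset_of_le hdl.le hc⟩) (b := ⟨_, hb⟩) (hAd _ hs) (hAd _ hc) ?_
    refine H p _ _ (fun i => vonNeumann_subset_of_le hda (hp i))
      (Ordinal.toZFSet_mem_toZFSet_iff.2 (hom.trans_le hma)) rfl fun z => ?_
    rw [← hRw z, iff_iff_eq]
    show R _ _ = R _ _
    congr 1
    funext i
    exact (hwt i).symm
  exact (Set.eq_empty_iff_forall_notMem.1 hdef) _ ⟨hyd, _, ⟨hdo, hom⟩, rfl⟩

end RankToRank

/-! ### The induction along the product -/

theorem lemma21 (lam : Ordinal.{u}) (hlam : Order.IsSuccLimit lam)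
    (j : ZFSet.{u}) (hj : j ∈ RankToRank.Emb lam)
    (δ μ : Ordinal.{u}) (hδ : δ.IsInitial) (hμ : μ.IsInitial)
    (hcrit : RankToRank.crit j < δ) (hδμ : δ < μ) (hμlam : μ < lam)
    (hdef : RankToRank.DefIn lam (RankToRank.rng j ∪ {x | x ∈ ZFSet.vonNeumann δ}) ∩
      RankToRank.interval δ μ = ∅)
    (n : ℕ) (js : ℕ → ZFSet.{u}) (hjs : ∀ i < n, js i ∈ RankToRank.Emb lam)
    (hcrits : ∀ i ≤ n, RankToRank.crit (RankToRank.leftProd lam j js i) < δ) :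
    RankToRank.rng (RankToRank.leftProd lam j js n) ∩ RankToRank.interval δ μ = ∅ := by
  -- An initial ordinal above the critical point is above `ω`, hence an infinite cardinal and a
  -- limit.
  have hlim : Order.IsSuccLimit δ := by
    obtain ⟨e, he, rfl⟩ := hj
    have hω := (RankToRank.omega0_lt_crit hlam he).trans hcrit
    rw [← hδ.ord_card]
    exact Cardinal.isSuccLimit_ord (Ordinal.aleph0_le_card.2 hω.le)
  have key : ∀ i ≤ n, RankToRank.leftProd lam j js i ∈ RankToRank.Emb lam ∧
      RankToRank.DefIn lam (RankToRank.rng (RankToRank.leftProd lam j js i) ∪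
        {x | x ∈ ZFSet.vonNeumann δ}) ∩ RankToRank.interval δ μ = ∅ := by
    intro i
    induction i with
    | zero => exact fun _ => ⟨hj, hdef⟩
    | succ i ih =>
      intro hi
      obtain ⟨⟨e, he, hei⟩, hdef'⟩ := ih (Nat.le_of_succ_le hi)
      obtain ⟨f, hf, hfi⟩ := hjs i hi
      obtain ⟨g, hg, happ⟩ := RankToRank.exists_embedding_app (e := e) hlam hf
      have hgi : RankToRank.leftProd lam j js (i + 1) = RankToRank.graph g := by
        rw [RankToRank.leftProd, hei, hfi, happ]
      have hcr := hcrits (i + 1) hi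
      rw [hgi] at hcr ⊢
      rw [hei] at hdef'
      exact ⟨⟨g, hg, rfl⟩, RankToRank.defIn_app_inter_interval hlam happ hg hlim
        (hδμ.trans hμlam) hcr hdef'⟩
  obtain ⟨⟨e, he, hei⟩, hdef'⟩ := key n le_rfl
  rw [hei] at hdef' ⊢
  refine Set.eq_empty_iff_forall_notMem.2 fun y hy =>
    Set.eq_empty_iff_forall_notMem.1 hdef' y ⟨?_, hy.2⟩
  obtain ⟨x, rfl⟩ := RankToRank.mem_rng_graph.1 hy.1
  exact ⟨(e x).2, Set.Definable.singleton_of_mem _ (Or.inl hy.1)⟩
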